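/- **Setting.** Let $M$ be a von Neumann algebra on a separable complex Hilbert space $H$, with predual $M_*$ (its ultraweakly continuous linear functionals), and let $\tau$ be a faithful normal trace on $M$ (so $M$ is finite). A bounded sequence $(u_n)$ of scalars *almost converges* to $u$ if $\frac1{n+1}\sum_{i=k}^{k+n}u_i\to u$ as $n\to\infty$, uniformly in $k$; it *strongly almost converges* to $u$ if $(|u_n-u|)_n$ almost converges to $0$. A *regular gauge* is a map $p\colon\mathbb N\to(0,\infty)$ for which there is a constant $c_p>0$ such that $p(n+1)/p(n)$ strongly almost converges to $c_p$ and $c_p^n/p(n)$ strongly almost converges to $1$. A set $\mathcal S\subset M$ is *dominated* by $p$ if $\|T^n\|\le p(n)$ for all $T\in\mathcal S$ and $n\ge1$; it is *abelian* if its elements commute with each other. For a nonempty abelian set $\mathcal S\subset M$ dominated by a regular gauge $p$ and $T\in\mathcal S$, let $E_T\colon M\to M$ be the weak*-continuous bounded operator to which the maps $X\mapsto p(n)^{-2}T^{*n}XT^n$ are weakly almost convergent, i.e. $\ell\big(p(n)^{-2}T^{*n}XT^n-E_T(X)\big)$ almost converges to $0$ for all $\ell\in M_*$ and $X\in M$.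 Let $\mathcal E(\mathcal S)$ be the semigroup generated under composition by $\{E_T:T\in\mathcal S\}$, regarded as a net indexed by itself for the order $\phi\le\phi'$ iff $\phi'=\phi''\phi$ for some $\phi''\in\mathcal E(\mathcal S)$. A bounded operator $E$ on $M$ is the (weak) limit of this net if $\ell(\phi(X))\to\ell(E(X))$ along it for all $\ell\in M_*$ and $X\in M$. For a weak*-continuous bounded operator $\phi$ on $M$, $\widehat\phi_\tau$ denotes, if it exists, the (unique) bounded operator on $M$ with $\tau(X\phi(Y))=\tau(\widehat\phi_\tau(X)Y)$ for all $X,Y\in M$. **Proposition 2.8.** Let $M$ and $\tau$ be as above, and let $\mathcal S\subset M$ be a nonempty abelian set dominated by a regular gauge $p$. Then the operators $E_T$ $(T\in\mathcal S)$ exist and the net $\mathcal E(\mathcal S)$ has a unique weak limit $E$. Assume that $E(I)$ is injective. Then for each $T\in\mathcal S$ there is a unitary $U_T\in M$ with $$\sqrt{E(I)}\,T=c_p\,U_T\sqrt{E(I)},$$ such that the set $\mathcal S_1=\{U_T:T\in\mathcal S\}$ is abelian. Moreover, the net $\mathcal E(\mathcal S_1)$ (formed with the constant gauge $1$) has a weak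 limit $F$, the operators $\widehat E_\tau$ and $\widehat F_\tau$ exist, and for all $X\in M$: (i) $E\big(\sqrt{E(I)}\,X\sqrt{E(I)}\big)=\sqrt{E(I)}\,F(X)\sqrt{E(I)}$; (ii) $\sqrt{E(I)}\,\widehat E_\tau(X)\sqrt{E(I)}=\widehat F_\tau\big(\sqrt{E(I)}\,X\sqrt{E(I)}\big)$. -/

import Mathlib

noncomputable section

namespace VNSemigroup

/-- `u` almost converges to `c`: the averages of `u k, …, u (k + n)` tend to `c` as `n → ∞`,
uniformly in `k`.  (Such a sequence is automatically bounded.) -/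
def AlmostConverges {V : Type*} [NormedAddCommGroup V] [NormedSpace ℝ V] (u : ℕ → V) (c : V) :
    Prop :=
  TendstoUniformly (fun n k : ℕ => ((n : ℝ) + 1)⁻¹ • ∑ i ∈ Finset.Icc k (k + n), u i)
    (fun _ => c) Filter.atTop

/-- `u` strongly almost converges to `c`: the sequence `|u n - c|` almost converges to `0`. -/
def StronglyAlmostConverges (u : ℕ → ℝ) (c : ℝ) : Prop :=
  AlmostConverges (fun n => |u n - c|) 0

/-- `p` is a gauge with (unique) constant `c = c_p`. -/
structure IsGauge (p : ℕ → ℝ) (c : ℝ) : Prop where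
  pos : ∀ n, 0 < p n
  const_pos : 0 < c
  ratio : StronglyAlmostConverges (fun n => p (n + 1) / p n) c

/-- `p` is a regular gauge with constant `c = c_p`. -/
structure IsRegularGauge (p : ℕ → ℝ) (c : ℝ) : Prop extends IsGauge p c where
  regular : StronglyAlmostConverges (fun n => c ^ n / p n) 1

variable {H : Type*} [NormedAddCommGroup H] [InnerProductSpace ℂ H] [CompleteSpace H]

/-- The type of elements of the von Neumann algebra `M`, as a normed `*`-algebra
(a subalgebra of the bounded operators on `H`, with the operator norm). -/
abbrev Elem (M : VonNeumannAlgebra H) : Type _ := M.toStarSubalgebra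

variable (M : VonNeumannAlgebra H)

/-- Membership in the predual of `M`: `l` is ultraweakly continuous, i.e. of the form
`X ↦ ∑ n, ⟨X x_n, y_n⟩` with `∑ ‖x_n‖² < ∞` and `∑ ‖y_n‖² < ∞`. -/
def IsNormal (l : Elem M →ₗ[ℂ] ℂ) : Prop :=
  ∃ x y : ℕ → H, Summable (fun n => ‖x n‖ ^ 2) ∧ Summable (fun n => ‖y n‖ ^ 2) ∧
    ∀ X : Elem M, HasSum (fun n => inner ℂ (y n) ((X : H →L[ℂ] H) (x n))) (l X)

/-- `τ` is a faithful normal trace on `M`. -/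
structure IsFaithfulNormalTrace (τ : Elem M →ₗ[ℂ] ℂ) : Prop where
  normal : IsNormal M τ
  trace : ∀ A B : Elem M, τ (A * B) = τ (B * A)
  nonneg : ∀ A : Elem M, (A : H →L[ℂ] H).IsPositive → 0 ≤ (τ A).re ∧ (τ A).im = 0
  faithful : ∀ A : Elem M, (A : H →L[ℂ] H).IsPositive → τ A = 0 → A = 0

/-- The bounded operator `φ` on `M` is weak*-continuous: composing with `φ` maps the predual
of `M` into itself (the resulting map of the predual is `φ_*`). -/
def IsWeakStarContinuous (φ : Elem M →L[ℂ] Elem M) : Prop :=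
  ∀ l : Elem M →ₗ[ℂ] ℂ, IsNormal M l → IsNormal M (l ∘ₗ φ.toLinearMap)

/-- `φ` is `τ`-`M`-stable and `ψ` is the associated map on `M`: `φ` is weak*-continuous and
`φ_* l_X = l_{ψ X}` for every `X`, where `l_X = τ (X ·)`. -/
structure IsTraceDual (τ : Elem M →ₗ[ℂ] ℂ) (φ ψ : Elem M →L[ℂ] Elem M) : Prop where
  weakStarContinuous : IsWeakStarContinuous M φ
  dual : ∀ X Y : Elem M, τ (X * φ Y) = τ (ψ X * Y)

/-- The sequence `φ` of maps of `M` is weakly almost convergent to the weak*-continuous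
operator `ψ`. -/
structure WeaklyAlmostConverges (φ : ℕ → Elem M → Elem M) (ψ : Elem M →L[ℂ] Elem M) : Prop where
  weakStarContinuous : IsWeakStarContinuous M ψ
  converges : ∀ l : Elem M →ₗ[ℂ] ℂ, IsNormal M l → ∀ X : Elem M,
    AlmostConverges (fun n => l (φ n X - ψ X)) 0

/-- The map `X ↦ p(n)⁻² T*ⁿ X Tⁿ`. -/
def conjMap (p : ℕ → ℝ) (T : Elem M) (n : ℕ) (X : Elem M) : Elem M :=
  (((p n) ^ 2)⁻¹ : ℝ) • (star T ^ n * X * T ^ n)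

/-- `T` is dominated by `p`. -/
def IsDominatedBy (T : Elem M) (p : ℕ → ℝ) : Prop :=
  ∀ n : ℕ, 1 ≤ n → ‖T ^ n‖ ≤ p n

/-- Weak convergence to `E` of a semigroup `𝒢` of operators on `M`, regarded as a net indexed by
itself, for the order `φ₀ ≤ φ ↔ ∃ χ ∈ 𝒢, φ = χ ∘ φ₀`. -/
def NetWeaklyConverges (𝒢 : Set (Elem M →L[ℂ] Elem M)) (E : Elem M →L[ℂ] Elem M) : Prop :=
  ∀ l : Elem M →ₗ[ℂ] ℂ, IsNormal M l → ∀ X : Elem M, ∀ ε : ℝ, 0 < ε →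
    ∃ φ₀ ∈ 𝒢, ∀ φ ∈ 𝒢, (∃ χ ∈ 𝒢, φ = χ ∘L φ₀) → ‖l (φ X) - l (E X)‖ < ε

/-- `E` is the limit of the net `ℰ(S)` formed with the gauge `p`: for each `T ∈ S` the sequence
`X ↦ p(n)⁻² T*ⁿ X Tⁿ` is weakly almost convergent to an operator `e T`, and the semigroup
generated under composition by the `e T`, `T ∈ S`, weakly converges, as a net, to `E`. -/
def IsNetLimit (p : ℕ → ℝ) (S : Set (Elem M)) (E : Elem M →L[ℂ] Elem M) : Prop :=
  ∃ e : Elem M → (Elem M →L[ℂ] Elem M),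
    (∀ T ∈ S, WeaklyAlmostConverges M (conjMap M p T) (e T)) ∧
    NetWeaklyConverges M (Subsemigroup.closure (e '' S)) E

/-- The square root of a positive element of `M`, as an element of `M`. -/
def sqrt (A : Elem M) : Elem M :=
  ⟨CFC.sqrt (A : H →L[ℂ] H), by
    have hA : (A : H →L[ℂ] H) ∈ (M : Set (H →L[ℂ] H)) := A.2
    change CFC.sqrt (A : H →L[ℂ] H) ∈ (M : Set (H →L[ℂ] H))
    rw [← M.centralizer_centralizer] at hA ⊢
    intro b hb
    have h : Commute (A : H →L[ℂ] H) b := (hA b hb).symm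
    exact (h.cfcₙ_nnreal NNReal.sqrt).symm⟩

end VNSemigroup

end

noncomputable section

namespace VNSemigroup

open Filter Topology

variable {H : Type*} [NormedAddCommGroup H] [InnerProductSpace ℂ H] [CompleteSpace H]
variable {M : VonNeumannAlgebra H}

/-! ### The predual as a Banach space -/

/-! The faithful trace makes the injectivity hypothesis very strong: it forces `E 1 = 1`. The square
root is then the identity, `U_T = T / c`, and `F = E`.

For `V = T / c`, the map `X ↦ V* X V` extends to an operator on `L²(M, τ)` whose `n`-th power has
norm at most `‖Vⁿ‖²`. Regularity of the gauge bounds these powers, and brings the bound as close to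
`1` as desired at two consecutive exponents. This is enough for a mean ergodic theorem
(`almostConverges_pow`) in which the limit is the orthogonal projection on the fixed vectors, even
though the operator need not be a contraction. The limit descends to `M`, because bounded families
converging in `L²` converge weak* to elements of `M` (`exists_limit_of_tendsto_toL2`). So each `E_T`
is contractive, positive, idempotent and `τ`-symmetric (`exists_almostLimit`).

These projections commute, so their semigroup is a directed net along which `L²` norms decrease. It
converges to an operator `E` with the same properties (`IsProjectionSemigroup.exists_limit`).
Symmetry and idempotence give `τ (E 1 * (1 - E 1)) = 0`. Faithfulness then makes `E 1` a projection,
and an injective projection is the identity (`limit_one_eq_one`). Now `E_T 1 = 1` is fixed by `X ↦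
V* X V`, so `V` is an isometry, hence unitary because the trace is faithful. Both gauges give the
projection on the same fixed space (`WeaklyAlmostConverges.const_gauge`), whence `F = E`, and
symmetry makes `E` its own trace dual.

Passing from trace functionals to all normal ones rests on a Banach-space model of the predual, in
which the functionals `τ (X ·)` are dense (`IsPredualModel.dense_trace`). -/

/-- The vector functional `X ↦ ⟨X x, y⟩` on `M`. -/
def vectorFunctional (M : VonNeumannAlgebra H) (x y : H) : Elem M →L[ℂ] ℂ :=
  LinearMap.mkContinuous
    { toFun := fun X => inner ℂ y ((X : H →L[ℂ] H) x)
      map_add' := fun X Y => by simp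
      map_smul' := fun a X => by simp }
    (‖x‖ * ‖y‖) fun X => by
      change ‖inner ℂ y ((X : H →L[ℂ] H) x)‖ ≤ ‖x‖ * ‖y‖ * ‖(X : H →L[ℂ] H)‖
      calc _ ≤ ‖y‖ * ‖(X : H →L[ℂ] H) x‖ := norm_inner_le_norm _ _
        _ ≤ ‖y‖ * (‖(X : H →L[ℂ] H)‖ * ‖x‖) := by gcongr; exact ContinuousLinearMap.le_opNorm _ _
        _ = _ := by ring

@[simp]
theorem vectorFunctional_apply (x y : H) (X : Elem M) :
    vectorFunctional M x y X = inner ℂ y ((X : H →L[ℂ] H) x) := rfl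

theorem norm_vectorFunctional_le (x y : H) : ‖vectorFunctional M x y‖ ≤ ‖x‖ * ‖y‖ :=
  LinearMap.mkContinuous_norm_le _ (by positivity) _

theorem isNormal_vectorFunctional (x y : H) : IsNormal M (vectorFunctional M x y).toLinearMap := by
  refine ⟨Pi.single 0 x, Pi.single 0 y, ?_, ?_, fun X => ?_⟩
  · exact summable_of_ne_finset_zero (s := {0}) fun n hn => by
      simp [Pi.single_eq_of_ne (Finset.notMem_singleton.1 hn)]
  · exact summable_of_ne_finset_zero (s := {0}) fun n hn => by
      simp [Pi.single_eq_of_ne (Finset.notMem_singleton.1 hn)]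
  · convert hasSum_single 0 fun n hn => ?_
    · simp
    · simp [Pi.single_eq_of_ne hn]

/-- The series of vector functionals representing a normal functional converges in norm. -/
theorem IsNormal.exists_hasSum {l : Elem M →ₗ[ℂ] ℂ} (hl : IsNormal M l) :
    ∃ x y : ℕ → H, Summable (fun n => ‖x n‖ * ‖y n‖) ∧
      ∃ d : Elem M →L[ℂ] ℂ, d.toLinearMap = l ∧
        HasSum (fun n => vectorFunctional M (x n) (y n)) d := by
  obtain ⟨x, y, hx, hy, h⟩ := hl
  have hxy : Summable (fun n => ‖x n‖ * ‖y n‖) := by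
    refine Summable.of_nonneg_of_le (fun n => by positivity) (fun n => ?_) (hx.add hy)
    nlinarith [sq_nonneg (‖x n‖ - ‖y n‖), sq_nonneg (‖x n‖), sq_nonneg ‖y n‖]
  have hs : Summable (fun n => vectorFunctional M (x n) (y n)) :=
    Summable.of_norm_bounded hxy fun n => norm_vectorFunctional_le _ _
  refine ⟨x, y, hxy, _, ?_, hs.hasSum⟩
  ext X
  exact (hs.hasSum.mapL (ContinuousLinearMap.apply ℂ ℂ X)).unique (h X)

/-- A summable combination of vector functionals of vectors in the unit ball is normal. -/
theorem isNormal_of_hasSum {ι : Type*} (a : ι → ℂ) (ha : Summable fun i => ‖a i‖) (x y : ι → H)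
    (hx : ∀ i, ‖x i‖ ≤ 1) (hy : ∀ i, ‖y i‖ ≤ 1) (l : Elem M →ₗ[ℂ] ℂ)
    (h : ∀ X, HasSum (fun i => a i • vectorFunctional M (x i) (y i) X) (l X)) : IsNormal M l := by
  have hc : (Function.support fun i => ‖a i‖).Countable := ha.countable_support
  let s := Function.support fun i => ‖a i‖
  have : Countable s := hc
  -- The index type may be uncountable, but a summable family has countable support, which is
  -- enumerated in `ℕ` and extended by zero.
  obtain ⟨e, he⟩ := exists_injective_nat s
  have hsq : ∀ i, ‖((√‖a i‖ : ℝ) : ℂ)‖ ^ 2 = ‖a i‖ := fun i => by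
    rw [Complex.norm_real, Real.norm_eq_abs, sq_abs, Real.sq_sqrt (norm_nonneg _)]
  have key : ∀ (u : ι → H) (b : ι → ℂ), (∀ i, ‖u i‖ ≤ 1) → (∀ i, ‖b i‖ ^ 2 ≤ ‖a i‖) →
      Summable fun n => ‖Function.extend e (fun i : s => b i • u i) 0 n‖ ^ 2 := by
    intro u b hu hb
    have h1 : (fun n => ‖Function.extend e (fun i : s => b i • u i) 0 n‖ ^ 2) =
        Function.extend e (fun i : s => ‖b i • u i‖ ^ 2) 0 := by
      funext n
      by_cases hn : ∃ i, e i = n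
      · obtain ⟨i, rfl⟩ := hn
        simp [he.extend_apply]
      · simp [Function.extend_apply' _ _ _ hn]
    rw [h1, summable_extend_zero he]
    refine Summable.of_nonneg_of_le (fun i => by positivity) (fun i => ?_)
      (ha.comp_injective Subtype.val_injective)
    rw [norm_smul, mul_pow]
    calc _ ≤ ‖a i‖ * 1 := by
          gcongr
          · exact hb i
          · exact pow_le_one₀ (norm_nonneg _) (hu i)
      _ = _ := by simp
  -- Each coefficient is split as `(a / √|a|) · √|a|`, so that both vector sequences have squared
  -- norms bounded by `|a i|`.
  refine ⟨Function.extend e (fun i : s => (a i / (√‖a i‖ : ℝ)) • x i) 0,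
    Function.extend e (fun i : s => ((√‖a i‖ : ℝ) : ℂ) • y i) 0,
    key x (fun i => a i / (√‖a i‖ : ℝ)) hx fun i => ?_,
    key y (fun i => ((√‖a i‖ : ℝ) : ℂ)) hy fun i => (hsq i).le, fun X => ?_⟩
  · rw [norm_div, div_pow, hsq, sq]
    by_cases h0 : ‖a i‖ = 0
    · simp [h0]
    · rw [mul_div_cancel_right₀ _ h0]
  · have h2 : (fun n => inner ℂ (Function.extend e (fun i : s => ((√‖a i‖ : ℝ) : ℂ) • y i) 0 n)
        ((X : H →L[ℂ] H) (Function.extend e (fun i : s => (a i / (√‖a i‖ : ℝ)) • x i) 0 n))) =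
        Function.extend e (fun i : s => a i • vectorFunctional M (x i) (y i) X) 0 := by
      funext n
      by_cases hn : ∃ i, e i = n
      · obtain ⟨i, rfl⟩ := hn
        have h0 : ((√‖a i‖ : ℝ) : ℂ) ≠ 0 := by
          have : ‖a i‖ ≠ 0 := i.2
          rw [Complex.ofReal_ne_zero]
          exact (Real.sqrt_pos.2 (lt_of_le_of_ne (norm_nonneg _) this.symm)).ne'
        simp only [he.extend_apply, inner_smul_left, map_smul, inner_smul_right,
          vectorFunctional_apply, Complex.conj_ofReal, smul_eq_mul]
        field_simp
      · simp [Function.extend_apply' _ _ _ hn]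
    rw [h2, hasSum_extend_zero he]
    have := (hasSum_subtype_iff_of_support_subset (s := s) (fun i hi => ?_)).2 (h X)
    · exact this
    · intro h0
      apply hi
      have : a i = 0 := norm_eq_zero.1 h0
      simp [this]

/-- A realisation of the predual of `M`: a Banach space `W` with an injective bounded map onto the
normal functionals such that vector functionals lift without increase of the bound. -/
structure IsPredualModel {W : Type*} [NormedAddCommGroup W] [NormedSpace ℂ W]
    (Q : W →L[ℂ] (Elem M →L[ℂ] ℂ)) : Prop where
  injective : Function.Injective Q
  lift : ∀ x y : H, ∃ w, Q w = vectorFunctional M x y ∧ ‖w‖ ≤ ‖x‖ * ‖y‖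
  normal : ∀ w, IsNormal M (Q w).toLinearMap

/-- Pairs of vectors in the unit ball. -/
abbrev UnitPairs (H : Type*) [NormedAddCommGroup H] : Type _ :=
  Metric.closedBall (0 : H) 1 × Metric.closedBall (0 : H) 1

/-- The map from `ℓ¹` to the predual sending basis vectors to vector functionals. -/
def sumFunctional (M : VonNeumannAlgebra H) :
    lp (fun _ : UnitPairs H => ℂ) 1 →L[ℂ] (Elem M →L[ℂ] ℂ) :=
  lp.tsumCLM ℂ (UnitPairs H) (Elem M →L[ℂ] ℂ) ∘L
    lp.mapCLM 1 (fun i : UnitPairs H =>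
      ContinuousLinearMap.toSpanSingleton ℂ (vectorFunctional M (i.1 : H) (i.2 : H)))
      zero_le_one fun i => by
        rw [ContinuousLinearMap.norm_toSpanSingleton]
        have h1 : ‖(i.1 : H)‖ ≤ 1 := mem_closedBall_zero_iff.1 i.1.2
        have h2 : ‖(i.2 : H)‖ ≤ 1 := mem_closedBall_zero_iff.1 i.2.2
        exact (norm_vectorFunctional_le _ _).trans (mul_le_one₀ h1 (norm_nonneg _) h2)

theorem summable_norm_lp_one {ι : Type*} (a : lp (fun _ : ι => ℂ) 1) : Summable fun i => ‖a i‖ := by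
  simpa using (lp.memℓp a).summable (by simp)

theorem hasSum_sumFunctional (a : lp (fun _ : UnitPairs H => ℂ) 1) :
    HasSum (fun i => a i • vectorFunctional M (i.1 : H) (i.2 : H)) (sumFunctional M a) := by
  have h : Summable (fun i => a i • vectorFunctional M (i.1 : H) (i.2 : H)) := by
    refine Summable.of_norm_bounded (summable_norm_lp_one a) fun i => ?_
    have h1 : ‖(i.1 : H)‖ ≤ 1 := mem_closedBall_zero_iff.1 i.1.2
    have h2 : ‖(i.2 : H)‖ ≤ 1 := mem_closedBall_zero_iff.1 i.2.2
    rw [norm_smul]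
    exact mul_le_of_le_one_right (norm_nonneg _)
      ((norm_vectorFunctional_le _ _).trans (mul_le_one₀ h1 (norm_nonneg _) h2))
  exact h.hasSum

instance : IsClosed ((sumFunctional M).ker : Set (lp (fun _ : UnitPairs H => ℂ) 1)) :=
  (sumFunctional M).isClosed_ker

/-- The predual of `M` as a quotient of `ℓ¹`. -/
abbrev Predual (M : VonNeumannAlgebra H) : Type _ :=
  lp (fun _ : UnitPairs H => ℂ) 1 ⧸ (sumFunctional M).ker

/-- The embedding of the predual in the dual. -/
def predualMap (M : VonNeumannAlgebra H) : Predual M →L[ℂ] (Elem M →L[ℂ] ℂ) :=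
  (sumFunctional M).ker.liftQL (sumFunctional M) le_rfl

theorem predualMap_mk (a : lp (fun _ : UnitPairs H => ℂ) 1) :
    predualMap M (Submodule.Quotient.mk a) = sumFunctional M a := rfl

theorem isPredualModel_predualMap : IsPredualModel (predualMap M) where
  injective := by
    rw [injective_iff_map_eq_zero]
    intro w
    obtain ⟨a, rfl⟩ := Submodule.Quotient.mk_surjective _ w
    intro h
    exact (Submodule.Quotient.mk_eq_zero _).2 h
  lift x y := by
    classical
    have hu : ∀ z : H, ((‖z‖⁻¹ : ℝ) : ℂ) • z ∈ Metric.closedBall (0 : H) 1 := fun z => by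
      rw [mem_closedBall_zero_iff, norm_smul, Complex.norm_real, norm_inv, norm_norm]
      exact inv_mul_le_one
    have hz : ∀ z : H, ((‖z‖ : ℝ) : ℂ) • ((‖z‖⁻¹ : ℝ) : ℂ) • z = z := fun z => by
      rcases eq_or_ne z 0 with rfl | h
      · simp
      · rw [smul_smul, ← Complex.ofReal_mul, mul_inv_cancel₀ (norm_ne_zero_iff.2 h)]
        simp
    let i : UnitPairs H := (⟨_, hu x⟩, ⟨_, hu y⟩)
    let a : lp (fun _ : UnitPairs H => ℂ) 1 := lp.single 1 i ((‖x‖ * ‖y‖ : ℝ) : ℂ)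
    refine ⟨Submodule.Quotient.mk a, ?_, ?_⟩
    · rw [predualMap_mk]
      refine (hasSum_sumFunctional a).unique ?_
      have : vectorFunctional M x y = a i • vectorFunctional M (i.1 : H) (i.2 : H) := by
        have : a i = ((‖x‖ * ‖y‖ : ℝ) : ℂ) := lp.single_apply_self _ _ _
        rw [this]
        ext X
        have h1 := hz x
        have h2 := hz y
        calc vectorFunctional M x y X = vectorFunctional M (((‖x‖ : ℝ) : ℂ) • (i.1 : H))
              (((‖y‖ : ℝ) : ℂ) • (i.2 : H)) X := by simp only [i, hz]
          _ = _ := by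
              simp only [vectorFunctional_apply, map_smul, inner_smul_left, inner_smul_right,
                Complex.conj_ofReal, smul_apply, smul_eq_mul,
                Complex.ofReal_mul]
              ring
      rw [this]
      refine hasSum_single i fun j hj => ?_
      have : a j = 0 := lp.single_apply_ne _ _ _ hj
      simp only [this]
      exact zero_smul ℂ (vectorFunctional M (j.1 : H) (j.2 : H))
    · refine (Submodule.Quotient.norm_mk_le _ _).trans ?_
      rw [lp.norm_single (by simp), Complex.norm_real, Real.norm_of_nonneg (by positivity)]
  normal w := by
    obtain ⟨a, rfl⟩ := Submodule.Quotient.mk_surjective _ w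
    rw [predualMap_mk]
    refine isNormal_of_hasSum (fun i => a i) (summable_norm_lp_one a) (fun i => (i.1 : H))
      (fun i => (i.2 : H)) (fun i => mem_closedBall_zero_iff.1 i.1.2) (fun i => mem_closedBall_zero_iff.1 i.2.2) _
      fun X => ?_
    exact (hasSum_sumFunctional a).mapL (ContinuousLinearMap.apply ℂ ℂ X)

/-! ### Duality between a predual model and `M` -/

namespace IsPredualModel

variable {W : Type*} [NormedAddCommGroup W] [NormedSpace ℂ W] {Q : W →L[ℂ] (Elem M →L[ℂ] ℂ)}

/-- Bounded functionals on the predual are given by the elements of `M`. -/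
theorem exists_elem_of_dual (hQ : IsPredualModel Q) [CompleteSpace W] (g : W →L[ℂ] ℂ) :
    ∃ B : Elem M, ‖B‖ ≤ ‖g‖ ∧ ∀ w, g w = Q w B := by
  choose w hw hwn using hQ.lift
  -- Injectivity of `Q` makes the chosen lifts sesquilinear in the vectors, so `g` composed with
  -- them is a bounded form, represented by an operator `B`.
  have hadd : ∀ x x' y, w (x + x') y = w x y + w x' y := fun x x' y => hQ.injective <| by
    ext X; simp [hw]
  have hsmul : ∀ (a : ℂ) x y, w (a • x) y = a • w x y := fun a x y => hQ.injective <| by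
    ext X; simp [hw]
  have hadd' : ∀ x y y', w x (y + y') = w x y + w x y' := fun x x' y => hQ.injective <| by
    ext X; simp [hw]
  have hsmul' : ∀ (a : ℂ) x y, w x (a • y) = (starRingEnd ℂ a) • w x y :=
    fun a x y => hQ.injective <| by ext X; simp [hw, mul_comm]
  have hb : ∀ y x, ‖g (w x y)‖ ≤ ‖g‖ * ‖y‖ * ‖x‖ := fun y x =>
    calc _ ≤ ‖g‖ * ‖w x y‖ := g.le_opNorm _
      _ ≤ ‖g‖ * (‖x‖ * ‖y‖) := by gcongr; exact hwn x y
      _ = _ := by ring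
  let b : H →L⋆[ℂ] H →L[ℂ] ℂ := LinearMap.mkContinuous₂
    (LinearMap.mk₂'ₛₗ (starRingEnd ℂ) (RingHom.id ℂ) (fun y x => g (w x y))
      (fun y y' x => by rw [hadd', map_add]) (fun a y x => by rw [hsmul', map_smul])
      (fun y x x' => by rw [hadd, map_add]) (fun a y x => by rw [hsmul, map_smul]; rfl))
    ‖g‖ hb
  have hbapp : ∀ y x, b y x = g (w x y) := fun y x => rfl
  let B' := InnerProductSpace.continuousLinearMapOfBilin b
  let B : H →L[ℂ] H := ContinuousLinearMap.adjoint B'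
  have hB : ∀ x y, inner ℂ y (B x) = g (w x y) := fun x y => by
    rw [ContinuousLinearMap.adjoint_inner_right,
      InnerProductSpace.continuousLinearMapOfBilin_apply, hbapp]
  have hBn : ‖B‖ ≤ ‖g‖ := by
    refine ContinuousLinearMap.opNorm_le_bound _ (norm_nonneg _) fun x => ?_
    have h := hb (B x) x
    rw [← hB, inner_self_eq_norm_sq_to_K] at h
    have h2 : ‖B x‖ * ‖B x‖ ≤ (‖g‖ * ‖x‖) * ‖B x‖ := by
      have : ‖(((‖B x‖ : ℝ) : ℂ)) ^ 2‖ = ‖B x‖ * ‖B x‖ := by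
        rw [norm_pow, Complex.norm_real, norm_norm, sq]
      calc _ = _ := this.symm
        _ ≤ _ := h
        _ = _ := by ring
    rcases (norm_nonneg (B x)).eq_or_lt with h0 | h0
    · rw [← h0]; positivity
    · exact le_of_mul_le_mul_right h2 h0
  -- Double commutant: for `A` in the commutant, the vector functionals of `(A x, y)` and `(x, A*
  -- y)` agree on `M`, so their lifts coincide and `B` commutes with `A`.
  have hmem : B ∈ (M : Set (H →L[ℂ] H)) := by
    rw [← M.centralizer_centralizer]
    intro A hA
    ext x
    refine ext_inner_left ℂ fun y => ?_
    have hw' : w (A x) y = w x (ContinuousLinearMap.adjoint A y) := hQ.injective <| by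
      ext X
      have hX : (X : H →L[ℂ] H) * A = A * X := hA X X.2
      have hX' : (X : H →L[ℂ] H) (A x) = A ((X : H →L[ℂ] H) x) :=
        congrArg (fun f : H →L[ℂ] H => f x) hX
      simp only [hw, vectorFunctional_apply, hX', ContinuousLinearMap.adjoint_inner_left]
    change inner ℂ y (A (B x)) = inner ℂ y (B (A x))
    rw [hB, hw', ← hB, ContinuousLinearMap.adjoint_inner_left]
  refine ⟨⟨B, hmem⟩, hBn, fun v => ?_⟩
  obtain ⟨x, y, hxy, d, hd, hs⟩ := (hQ.normal v).exists_hasSum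
  have hd' : d = Q v := ContinuousLinearMap.coe_injective hd
  have hws : Summable fun n => w (x n) (y n) :=
    Summable.of_norm_bounded hxy fun n => hwn _ _
  -- The norm bound on lifts makes the series converge in `W` itself, so `g` can be evaluated
  -- termwise.
  have hv : HasSum (fun n => w (x n) (y n)) v := by
    convert hws.hasSum
    refine hQ.injective ?_
    rw [← hd']
    refine hs.unique ?_
    simpa only [hw] using hws.hasSum.mapL Q
  refine (hv.mapL g).unique ?_
  have := hs.mapL (ContinuousLinearMap.apply ℂ ℂ (⟨B, hmem⟩ : Elem M))
  simp only [ContinuousLinearMap.apply_apply, vectorFunctional_apply, hB, hd'] at this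
  exact this

/-- A norming functional of `w` is evaluation at an element of the unit ball of `M`. The bound makes
the range of `Q` closed. -/
theorem norm_le (hQ : IsPredualModel Q) [CompleteSpace W] (w : W) : ‖w‖ ≤ ‖Q w‖ := by
  obtain ⟨g, hg, hgw⟩ := exists_dual_vector'' ℂ w
  obtain ⟨B, hB, hBw⟩ := hQ.exists_elem_of_dual g
  calc ‖w‖ = ‖g w‖ := by rw [hgw]; simp
    _ = ‖Q w B‖ := by rw [hBw]
    _ ≤ ‖Q w‖ * ‖B‖ := (Q w).le_opNorm _
    _ ≤ ‖Q w‖ * 1 := by gcongr; exact hB.trans hg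
    _ = _ := mul_one _

theorem exists_eq (hQ : IsPredualModel Q) [CompleteSpace W] {l : Elem M →ₗ[ℂ] ℂ}
    (hl : IsNormal M l) : ∃ w, (Q w).toLinearMap = l := by
  obtain ⟨x, y, hxy, d, hd, hs⟩ := hl.exists_hasSum
  choose w hw hwn using hQ.lift
  have hws : Summable fun n => w (x n) (y n) :=
    Summable.of_norm_bounded hxy fun n => hwn _ _
  refine ⟨∑' n, w (x n) (y n), ?_⟩
  rw [← hd]
  congr 1
  have := hws.hasSum.mapL Q
  simp only [hw] at this
  exact this.unique hs

end IsPredualModel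

/-- The predual is norm closed in the dual. -/
theorem isClosed_setOf_isNormal : IsClosed {d : Elem M →L[ℂ] ℂ | IsNormal M d.toLinearMap} := by
  have hQ := isPredualModel_predualMap (M := M)
  have : {d : Elem M →L[ℂ] ℂ | IsNormal M d.toLinearMap} = Set.range (predualMap M) := by
    ext d
    constructor
    · intro h
      obtain ⟨w, hw⟩ := hQ.exists_eq h
      exact ⟨w, ContinuousLinearMap.coe_injective hw⟩
    · rintro ⟨w, rfl⟩
      exact hQ.normal w
  rw [this]
  refine AntilipschitzWith.isClosed_range (K := 1) ?_ (predualMap M).uniformContinuous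
  exact AddMonoidHomClass.antilipschitz_of_bound _ fun w => by simpa using hQ.norm_le w

/-! ### Functionals `τ (X ·)` -/

theorem IsNormal.mul_left {l : Elem M →ₗ[ℂ] ℂ} (hl : IsNormal M l) (X : Elem M) :
    IsNormal M (l ∘ₗ LinearMap.mulLeft ℂ X) := by
  obtain ⟨x, y, hx, hy, h⟩ := hl
  refine ⟨x, fun n => ((star X : Elem M) : H →L[ℂ] H) (y n), hx, ?_, fun Y => ?_⟩
  · refine Summable.of_nonneg_of_le (fun n => by positivity) (fun n => ?_)
      (hy.mul_left (‖((star X : Elem M) : H →L[ℂ] H)‖ ^ 2))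
    rw [← mul_pow]
    gcongr
    exact ContinuousLinearMap.le_opNorm _ _
  · have h1 := h (X * Y)
    have h2 : ∀ n, inner ℂ (((star X : Elem M) : H →L[ℂ] H) (y n)) ((Y : H →L[ℂ] H) (x n)) =
        inner ℂ (y n) (((X * Y : Elem M) : H →L[ℂ] H) (x n)) := fun n =>
      ContinuousLinearMap.adjoint_inner_left _ _ _
    simp only [h2]
    exact h1

variable {τ : Elem M →ₗ[ℂ] ℂ}

theorem IsFaithfulNormalTrace.eq_zero_of_forall (hτ : IsFaithfulNormalTrace M τ) {B : Elem M}
    (h : ∀ X, τ (X * B) = 0) : B = 0 := by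
  have h1 : star B * B = 0 := by
    refine hτ.faithful _ ?_ (h _)
    exact ContinuousLinearMap.isPositive_adjoint_comp_self (B : H →L[ℂ] H)
  exact CStarRing.star_mul_self_eq_zero_iff B |>.1 h1

theorem IsFaithfulNormalTrace.eq_of_forall (hτ : IsFaithfulNormalTrace M τ) {A B : Elem M}
    (h : ∀ X, τ (X * A) = τ (X * B)) : A = B :=
  sub_eq_zero.1 <| hτ.eq_zero_of_forall fun X => by rw [mul_sub, map_sub, h, sub_self]

/-- The predual vectors representing functionals `τ (X ·)` are dense. -/
theorem IsPredualModel.dense_trace {W : Type*} [NormedAddCommGroup W] [NormedSpace ℂ W]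
    {Q : W →L[ℂ] (Elem M →L[ℂ] ℂ)} (hQ : IsPredualModel Q) [CompleteSpace W]
    (hτ : IsFaithfulNormalTrace M τ) : Dense {w | ∃ X, ∀ Y, Q w Y = τ (X * Y)} := by
  let R : Submodule ℂ W :=
    { carrier := {w | ∃ X, ∀ Y, Q w Y = τ (X * Y)}
      zero_mem' := ⟨0, fun Y => by simp⟩
      add_mem' := by
        rintro v w ⟨X, hX⟩ ⟨Y, hY⟩
        exact ⟨X + Y, fun Z => by simp [hX, hY, add_mul]⟩
      smul_mem' := by
        rintro a w ⟨X, hX⟩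
        exact ⟨a • X, fun Z => by simp [hX]⟩ }
  change Dense (R : Set W)
  intro w
  by_contra hw
  let K := R.topologicalClosure
  have hK : IsClosed (K : Set W) := R.isClosed_topologicalClosure
  have hw' : ‖K.mkQL w‖ ≠ 0 := by
    rw [norm_ne_zero_iff]
    intro h
    exact hw ((Submodule.Quotient.mk_eq_zero K).1 h)
  obtain ⟨g, -, hg⟩ := exists_dual_vector ℂ (K.mkQL w) hw'
  -- Hahn–Banach on the quotient: the separating functional is evaluation at some `B` with `τ (X *
  -- B) = 0` for all `X`, and faithfulness forces `B = 0`.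
  obtain ⟨B, -, hB⟩ := hQ.exists_elem_of_dual (g ∘L K.mkQL)
  have hB0 : B = 0 := hτ.eq_zero_of_forall fun X => by
    obtain ⟨v, hv⟩ := hQ.exists_eq (hτ.normal.mul_left X)
    have hv' : ∀ Y, Q v Y = τ (X * Y) := fun Y => congrArg (fun l : Elem M →ₗ[ℂ] ℂ => l Y) hv
    have hvK : K.mkQL v = 0 :=
      (Submodule.Quotient.mk_eq_zero K).2 (R.le_topologicalClosure ⟨X, hv'⟩)
    rw [← hv', ← hB]
    simp only [ContinuousLinearMap.comp_apply, hvK, map_zero]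
  have : g (K.mkQL w) = 0 := by
    have := hB w
    rwa [hB0, map_zero] at this
  rw [this] at hg
  exact hw' (Complex.ofReal_eq_zero.1 hg.symm)

/-- A bounded net of elements of `M` whose pairings with `M` under the trace converge is weak*
convergent. -/
theorem IsFaithfulNormalTrace.exists_limit (hτ : IsFaithfulNormalTrace M τ) {ι : Type*}
    {F : Filter ι} [F.NeBot] (A : ι → Elem M) (C : ℝ) (hA : ∀ i, ‖A i‖ ≤ C)
    (h : ∀ X, ∃ a, Tendsto (fun i => τ (X * A i)) F (𝓝 a)) :
    ∃ B : Elem M, ‖B‖ ≤ C ∧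
      ∀ l : Elem M →ₗ[ℂ] ℂ, IsNormal M l → Tendsto (fun i => l (A i)) F (𝓝 (l B)) := by
  have hQ := isPredualModel_predualMap (M := M)
  set Q := predualMap M
  have hC : 0 ≤ C := by
    obtain ⟨i⟩ := F.nonempty_of_neBot
    exact (norm_nonneg _).trans (hA i)
  have hQn : ∀ w X, ‖Q w X‖ ≤ ‖w‖ * ‖Q‖ * ‖X‖ := fun w X =>
    ((Q w).le_opNorm X).trans (by rw [mul_comm ‖w‖]; gcongr; exact Q.le_opNorm w)
  -- Convergence on the dense set of trace functionals and boundedness of the net give a Cauchy net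
  -- for every `w`.
  have hlim : ∀ w, ∃ a, Tendsto (fun i => Q w (A i)) F (𝓝 a) := by
    intro w
    rw [← cauchy_map_iff_exists_tendsto, Metric.cauchy_iff]
    refine ⟨inferInstance, fun ε hε => ?_⟩
    have hD : 0 < ‖Q‖ * C + 1 := by positivity
    obtain ⟨v, ⟨X, hX⟩, hv⟩ := (hQ.dense_trace hτ).exists_dist_lt w
      (by positivity : 0 < ε / 6 / (‖Q‖ * C + 1))
    obtain ⟨a, ha⟩ := h X
    have hvw : ∀ i, ‖Q w (A i) - τ (X * A i)‖ ≤ ε / 6 := fun i => by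
      rw [← hX, ← sub_apply, ← map_sub]
      have hv1 : ‖w - v‖ < ε / 6 / (‖Q‖ * C + 1) := by
        rw [← dist_eq_norm]; exact hv
      rw [lt_div_iff₀ hD] at hv1
      calc _ ≤ ‖w - v‖ * ‖Q‖ * ‖A i‖ := hQn _ _
        _ ≤ ‖w - v‖ * ‖Q‖ * C := by gcongr; exact hA i
        _ ≤ ‖w - v‖ * (‖Q‖ * C + 1) := by nlinarith [norm_nonneg (w - v)]
        _ ≤ _ := hv1.le
    refine ⟨_, image_mem_map (ha (Metric.ball_mem_nhds a (by positivity : (0 : ℝ) < ε / 6))), ?_⟩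
    rintro _ ⟨i, hi, rfl⟩ _ ⟨j, hj, rfl⟩
    have hi' : ‖τ (X * A i) - a‖ < ε / 6 := by simpa [dist_eq_norm] using hi
    have hj' : ‖τ (X * A j) - a‖ < ε / 6 := by simpa [dist_eq_norm] using hj
    rw [dist_eq_norm]
    have : Q w (A i) - Q w (A j) = (Q w (A i) - τ (X * A i)) + (τ (X * A i) - a) -
        ((Q w (A j) - τ (X * A j)) + (τ (X * A j) - a)) := by ring
    rw [this]
    refine (norm_sub_le _ _).trans_lt ?_
    linarith [norm_add_le (Q w (A i) - τ (X * A i)) (τ (X * A i) - a), hvw i, hvw j,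
      norm_add_le (Q w (A j) - τ (X * A j)) (τ (X * A j) - a)]
  choose g hg using hlim
  let G : Predual M →ₗ[ℂ] ℂ :=
    { toFun := g
      map_add' := fun v w => tendsto_nhds_unique (hg (v + w)) <| by
        simpa only [map_add, add_apply] using (hg v).add (hg w)
      map_smul' := fun a w => tendsto_nhds_unique (hg (a • w)) <| by
        simp only [map_smul, smul_apply, RingHom.id_apply]
        exact (hg w).const_smul a }
  have hQA : ∀ w i, ‖Q w (A i)‖ ≤ ‖Q‖ * C * ‖w‖ := fun w i =>
    calc _ ≤ ‖w‖ * ‖Q‖ * ‖A i‖ := hQn _ _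
      _ ≤ ‖w‖ * ‖Q‖ * C := by gcongr; exact hA i
      _ = _ := by ring
  obtain ⟨B, -, hB⟩ := hQ.exists_elem_of_dual
    (G.mkContinuous (‖Q‖ * C) fun w => le_of_tendsto (hg w).norm (Eventually.of_forall (hQA w)))
  have hB' : ∀ w, g w = Q w B := hB
  have hconv : ∀ l : Elem M →ₗ[ℂ] ℂ, IsNormal M l → Tendsto (fun i => l (A i)) F (𝓝 (l B)) := by
    intro l hl
    obtain ⟨w, rfl⟩ := hQ.exists_eq hl
    have := hg w
    rwa [hB' w] at this
  refine ⟨B, ?_, hconv⟩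
  -- The duality only gives the bound `‖Q‖ * C`. The sharp bound `C` comes from testing against the
  -- vector functional with `y = B x`.
  refine ContinuousLinearMap.opNorm_le_bound _ hC fun x => ?_
  set y := (B : H →L[ℂ] H) x with hy
  have h1 : ‖vectorFunctional M x y B‖ ≤ C * ‖x‖ * ‖y‖ := by
    refine le_of_tendsto (hconv _ (isNormal_vectorFunctional x y)).norm
      (Eventually.of_forall fun i => ?_)
    calc _ ≤ ‖vectorFunctional M x y‖ * ‖A i‖ := ContinuousLinearMap.le_opNorm _ _
      _ ≤ (‖x‖ * ‖y‖) * C := by gcongr; exacts [norm_vectorFunctional_le x y, hA i]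
      _ = _ := by ring
  have h2 : ‖vectorFunctional M x y B‖ = ‖y‖ * ‖y‖ := by
    rw [vectorFunctional_apply, ← hy, inner_self_eq_norm_sq_to_K, norm_pow, sq]
    simp
  rw [h2] at h1
  rcases (norm_nonneg y).eq_or_lt with h0 | h0
  · change ‖y‖ ≤ _
    rw [← h0]; positivity
  · exact le_of_mul_le_mul_right h1 h0

/-- Bounded nets converging in the pairing with `M` under the trace converge weak*. -/
theorem IsFaithfulNormalTrace.tendsto_of_trace (hτ : IsFaithfulNormalTrace M τ) {ι : Type*}
    {F : Filter ι} [F.NeBot] {A : ι → Elem M} {C : ℝ} (hA : ∀ i, ‖A i‖ ≤ C) {B : Elem M}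
    (h : ∀ X, Tendsto (fun i => τ (X * A i)) F (𝓝 (τ (X * B)))) :
    ‖B‖ ≤ C ∧ ∀ l : Elem M →ₗ[ℂ] ℂ, IsNormal M l → Tendsto (fun i => l (A i)) F (𝓝 (l B)) := by
  obtain ⟨B', hB', hl⟩ := hτ.exists_limit A C hA fun X => ⟨_, h X⟩
  have : B = B' := hτ.eq_of_forall fun X =>
    tendsto_nhds_unique (h X) (hl _ (hτ.normal.mul_left X))
  exact this ▸ ⟨hB', hl⟩

/-- Operators with a dual for the trace are weak*-continuous. -/
theorem IsFaithfulNormalTrace.isWeakStarContinuous (hτ : IsFaithfulNormalTrace M τ)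
    {φ ψ : Elem M →L[ℂ] Elem M} (h : ∀ X Y, τ (X * φ Y) = τ (ψ X * Y)) :
    IsWeakStarContinuous M φ := by
  intro l hl
  have hQ := isPredualModel_predualMap (M := M)
  obtain ⟨w, rfl⟩ := hQ.exists_eq hl
  let N : Set (Elem M →L[ℂ] ℂ) := {d | IsNormal M d.toLinearMap}
  -- Normality of `Q v ∘ φ` is a norm-closed condition on `v`, so it need only be checked on the
  -- dense set of trace functionals.
  have hcl : IsClosed {v | (predualMap M v) ∘L φ ∈ N} :=
    isClosed_setOf_isNormal.preimage
      (((ContinuousLinearMap.compL ℂ (Elem M) (Elem M) ℂ).flip φ).continuous.comp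
        (predualMap M).continuous)
  have hsub : {v | ∃ X, ∀ Y, predualMap M v Y = τ (X * Y)} ⊆
      {v | (predualMap M v) ∘L φ ∈ N} := by
    rintro v ⟨X, hX⟩
    change IsNormal M _
    convert hτ.normal.mul_left (ψ X) using 1
    ext Y
    exact (hX (φ Y)).trans (h X Y)
  exact hcl.closure_subset_iff.2 hsub (hQ.dense_trace hτ w)

/-! ### The Hilbert space of a faithful normal trace -/

theorem isPositive_star_mul_self (X : Elem M) : ((star X * X : Elem M) : H →L[ℂ] H).IsPositive :=
  ContinuousLinearMap.isPositive_adjoint_comp_self (X : H →L[ℂ] H)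

/-- Polarisation: `τ (Y* Y)` is real for `Y = X`, `1`, `1 + X` and `1 + iX`. -/
theorem IsFaithfulNormalTrace.map_star (hτ : IsFaithfulNormalTrace M τ) (X : Elem M) : τ (star X) = (starRingEnd ℂ) (τ X) := by
  have h : ∀ Y : Elem M, (τ (star Y * Y)).im = 0 := fun Y =>
    (hτ.nonneg _ (isPositive_star_mul_self Y)).2
  have h0 := h X
  have h1 : (τ 1).im = 0 := by simpa using h 1
  have h2 := h (1 + X)
  have h3 := h (1 + Complex.I • X)
  simp only [star_add, star_one, star_smul, add_mul, mul_add, one_mul, mul_one, map_add,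
    smul_mul_assoc, mul_smul_comm, map_smul, Complex.add_im, h1, h0, zero_add,
    add_zero, smul_eq_mul] at h2 h3
  simp [h0] at h3
  apply Complex.ext
  · simp; linarith
  · simp; linarith

/-- The algebra `M` with the inner product `⟨X, Y⟩ = τ (X* Y)`. -/
@[nolint unusedArguments]
def PreL2 (_hτ : IsFaithfulNormalTrace M τ) : Type _ := Elem M

section PreL2

variable (hτ : IsFaithfulNormalTrace M τ)

instance : AddCommGroup (PreL2 hτ) := inferInstanceAs (AddCommGroup (Elem M))
instance : Module ℂ (PreL2 hτ) := inferInstanceAs (Module ℂ (Elem M))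

/-- The identity map from `M` to its pre-Hilbert space. -/
def toPreL2 : Elem M ≃ₗ[ℂ] PreL2 hτ := LinearEquiv.refl ℂ (Elem M)

instance preL2Core : InnerProductSpace.Core ℂ (PreL2 hτ) where
  inner X Y := τ (star ((toPreL2 hτ).symm X) * (toPreL2 hτ).symm Y)
  conj_inner_symm X Y := by
    rw [← hτ.map_star, star_mul, star_star]
  re_inner_nonneg X := (hτ.nonneg _ (isPositive_star_mul_self _)).1
  add_left X Y Z := by simp [add_mul]
  smul_left X Y a := by simp
  definite X h := by
    have := hτ.faithful _ (isPositive_star_mul_self ((toPreL2 hτ).symm X)) h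
    simpa using (CStarRing.star_mul_self_eq_zero_iff _).1 this

instance : NormedAddCommGroup (PreL2 hτ) := (preL2Core hτ).toNormedAddCommGroup
instance : InnerProductSpace ℂ (PreL2 hτ) := InnerProductSpace.ofCore (preL2Core hτ).toCore

/-- The Hilbert space `L²(M, τ)`. -/
abbrev L2 : Type _ := UniformSpace.Completion (PreL2 hτ)

/-- The canonical map from `M` to `L²(M, τ)`. -/
def toL2 : Elem M →ₗ[ℂ] L2 hτ :=
  (UniformSpace.Completion.toComplL (𝕜 := ℂ) (E := PreL2 hτ)).toLinearMap ∘ₗ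
    (toPreL2 hτ).toLinearMap

theorem inner_toL2 (X Y : Elem M) : inner ℂ (toL2 hτ X) (toL2 hτ Y) = τ (star X * Y) :=
  UniformSpace.Completion.inner_coe (𝕜 := ℂ) (toPreL2 hτ X) (toPreL2 hτ Y)

theorem denseRange_toL2 : DenseRange (toL2 hτ) :=
  UniformSpace.Completion.denseRange_coe.comp (toPreL2 hτ).surjective.denseRange
    (UniformSpace.Completion.continuous_coe _)

theorem trace_mul_eq_inner (X Y : Elem M) :
    τ (X * Y) = inner ℂ (toL2 hτ (star X)) (toL2 hτ Y) := by
  rw [inner_toL2, star_star]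

theorem norm_toL2_sq (X : Elem M) : ((‖toL2 hτ X‖ ^ 2 : ℝ) : ℂ) = τ (star X * X) := by
  rw [← inner_toL2 hτ, inner_self_eq_norm_sq_to_K]
  simp

theorem norm_toL2_sq_re (X : Elem M) : ‖toL2 hτ X‖ ^ 2 = (τ (star X * X)).re := by
  rw [← norm_toL2_sq hτ X, Complex.ofReal_re]

theorem toL2_injective : Function.Injective (toL2 hτ) := by
  rw [injective_iff_map_eq_zero]
  intro X hX
  have h := norm_toL2_sq hτ X
  rw [hX, norm_zero] at h
  have := hτ.faithful _ (isPositive_star_mul_self X) (by simpa using h.symm)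
  exact (CStarRing.star_mul_self_eq_zero_iff _).1 this

theorem norm_toL2_star (X : Elem M) : ‖toL2 hτ (star X)‖ = ‖toL2 hτ X‖ := by
  rw [← sq_eq_sq₀ (norm_nonneg _) (norm_nonneg _), norm_toL2_sq_re hτ, norm_toL2_sq_re hτ, star_star,
    hτ.trace]

/-- The operator inequality `X* A* A X ≤ ‖A‖² X* X`, under the trace. -/
theorem norm_toL2_mul_le (A X : Elem M) : ‖toL2 hτ (A * X)‖ ≤ ‖A‖ * ‖toL2 hτ X‖ := by
  refine abs_le_of_sq_le_sq' ?_ (by positivity) |>.2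
  rw [mul_pow, norm_toL2_sq_re hτ, norm_toL2_sq_re hτ]
  have hpos : (((‖A‖ ^ 2 : ℝ) : ℂ) • (star X * X) - star (A * X) * (A * X) : Elem M).1.IsPositive := by
    rw [ContinuousLinearMap.isPositive_iff_complex]
    intro x
    have h1 : inner ℂ ((((‖A‖ ^ 2 : ℝ) : ℂ) • (star X * X) - star (A * X) * (A * X) : Elem M).1 x) x
        = ((‖A‖ ^ 2 * ‖X.1 x‖ ^ 2 - ‖A.1 (X.1 x)‖ ^ 2 : ℝ) : ℂ) := by
      have h2 : (((‖A‖ ^ 2 : ℝ) : ℂ) • (star X * X) - star (A * X) * (A * X) : Elem M).1 x =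
          ((‖A‖ ^ 2 : ℝ) : ℂ) • (ContinuousLinearMap.adjoint X.1) (X.1 x) -
          (ContinuousLinearMap.adjoint (A * X : Elem M).1) ((A * X : Elem M).1 x) := rfl
      rw [h2, inner_sub_left, inner_smul_left, ContinuousLinearMap.adjoint_inner_left,
        ContinuousLinearMap.adjoint_inner_left, inner_self_eq_norm_sq_to_K,
        inner_self_eq_norm_sq_to_K, Complex.conj_ofReal]
      push_cast
      rfl
    rw [h1]
    rw [RCLike.re_eq_complex_re, Complex.ofReal_re]
    refine ⟨rfl, ?_⟩
    have h3 : ‖A.1 (X.1 x)‖ ≤ ‖A‖ * ‖X.1 x‖ := ContinuousLinearMap.le_opNorm _ _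
    have h4 : ‖A.1 (X.1 x)‖ ^ 2 ≤ (‖A‖ * ‖X.1 x‖) ^ 2 := by gcongr
    rw [mul_pow] at h4
    linarith
  have := (hτ.nonneg _ hpos).1
  rw [map_sub, map_smul, smul_eq_mul, Complex.sub_re, Complex.re_ofReal_mul] at this
  linarith

/-- By traciality the involution is isometric in `L²`, which turns right multiplication into left
multiplication. -/
theorem norm_toL2_mul_le' (A X : Elem M) : ‖toL2 hτ (X * A)‖ ≤ ‖A‖ * ‖toL2 hτ X‖ := by
  rw [← norm_toL2_star hτ, star_mul, ← norm_toL2_star hτ X, ← norm_star A]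
  exact norm_toL2_mul_le hτ _ _

/-- The extension to `L²` of the map `X ↦ A* X A`. -/
def conjL2 (A : Elem M) : L2 hτ →L[ℂ] L2 hτ :=
  ((toL2 hτ) ∘ₗ LinearMap.mulLeft ℂ (star A) ∘ₗ LinearMap.mulRight ℂ A).extendOfNorm (toL2 hτ)

theorem norm_toL2_conj_le (A X : Elem M) :
    ‖toL2 hτ (star A * (X * A))‖ ≤ ‖A‖ ^ 2 * ‖toL2 hτ X‖ :=
  calc _ ≤ ‖star A‖ * ‖toL2 hτ (X * A)‖ := norm_toL2_mul_le hτ _ _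
    _ ≤ ‖A‖ * (‖A‖ * ‖toL2 hτ X‖) := by
        rw [norm_star]; gcongr; exact norm_toL2_mul_le' hτ _ _
    _ = _ := by ring

theorem conjL2_toL2 (A X : Elem M) : conjL2 hτ A (toL2 hτ X) = toL2 hτ (star A * X * A) := by
  rw [conjL2, LinearMap.extendOfNorm_eq (denseRange_toL2 hτ) ⟨_, norm_toL2_conj_le hτ A⟩, mul_assoc]
  rfl

theorem norm_conjL2_apply_le (A : Elem M) (ξ : L2 hτ) : ‖conjL2 hτ A ξ‖ ≤ ‖A‖ ^ 2 * ‖ξ‖ :=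
  LinearMap.norm_extendOfNorm_apply_le (denseRange_toL2 hτ) _ (norm_toL2_conj_le hτ A) ξ

theorem clm_ext_toL2 {R S : L2 hτ →L[ℂ] L2 hτ} (h : ∀ X, R (toL2 hτ X) = S (toL2 hτ X)) : R = S :=
  DFunLike.coe_injective <| (denseRange_toL2 hτ).equalizer R.continuous S.continuous (funext h)

theorem conjL2_comp (A B : Elem M) : conjL2 hτ A ∘L conjL2 hτ B = conjL2 hτ (B * A) :=
  clm_ext_toL2 hτ fun X => by simp [conjL2_toL2, mul_assoc]

theorem conjL2_pow (A : Elem M) (n : ℕ) : conjL2 hτ A ^ n = conjL2 hτ (A ^ n) := by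
  induction n with
  | zero => exact clm_ext_toL2 hτ fun X => by simp [conjL2_toL2]
  | succ n ih =>
    rw [pow_succ, ih, pow_succ', ← conjL2_comp]
    rfl

end PreL2

/-! ### Almost convergence -/

section AlmostConvergence

variable {V : Type*} [NormedAddCommGroup V] [NormedSpace ℝ V]

/-- The average of `u k, …, u (k + n)`. -/
def windowMean (u : ℕ → V) (n k : ℕ) : V :=
  ((n : ℝ) + 1)⁻¹ • ∑ j ∈ Finset.range (n + 1), u (k + j)

theorem sum_Icc_eq_sum_range {V : Type*} [AddCommMonoid V] (u : ℕ → V) (n k : ℕ) :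
    ∑ i ∈ Finset.Icc k (k + n), u i = ∑ j ∈ Finset.range (n + 1), u (k + j) := by
  rw [← Finset.Ico_add_one_right_eq_Icc, Finset.sum_Ico_eq_sum_range]
  congr 2
  omega

theorem almostConverges_def (u : ℕ → V) (c : V) :
    AlmostConverges u c ↔ TendstoUniformly (windowMean u) (fun _ => c) atTop := by
  simp only [AlmostConverges, sum_Icc_eq_sum_range]
  rfl

theorem almostConverges_iff {u : ℕ → V} {c : V} :
    AlmostConverges u c ↔ ∀ ε > 0, ∃ N, ∀ n ≥ N, ∀ k, ‖windowMean u n k - c‖ < ε := by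
  rw [almostConverges_def, Metric.tendstoUniformly_iff]
  simp only [eventually_atTop, dist_eq_norm, norm_sub_rev c]

theorem windowMean_add (u v : ℕ → V) (n k : ℕ) :
    windowMean (fun i => u i + v i) n k = windowMean u n k + windowMean v n k := by
  simp [windowMean, Finset.sum_add_distrib]

theorem windowMean_const (c : V) (n k : ℕ) : windowMean (fun _ => c) n k = c := by
  have : ((n : ℝ) + 1) ≠ 0 := by positivity
  rw [windowMean, Finset.sum_const, Finset.card_range, ← Nat.cast_smul_eq_nsmul ℝ, smul_smul]
  push_cast
  rw [inv_mul_cancel₀ this, one_smul]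

theorem norm_windowMean_le {u : ℕ → V} {a : ℕ → ℝ} (h : ∀ i, ‖u i‖ ≤ a i) (n k : ℕ) :
    ‖windowMean u n k‖ ≤ windowMean a n k := by
  rw [windowMean, windowMean, norm_smul, Real.norm_of_nonneg (by positivity), smul_eq_mul]
  gcongr
  exact (norm_sum_le _ _).trans (Finset.sum_le_sum fun i _ => h _)

theorem norm_windowMean_le_const {u : ℕ → V} {C : ℝ} (h : ∀ i, ‖u i‖ ≤ C) (n k : ℕ) :
    ‖windowMean u n k‖ ≤ C :=
  (norm_windowMean_le h n k).trans_eq (windowMean_const C n k)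

theorem windowMean_map {V' : Type*} [NormedAddCommGroup V'] [NormedSpace ℝ V'] (f : V →ₗ[ℝ] V')
    (u : ℕ → V) (n k : ℕ) : windowMean (fun i => f (u i)) n k = f (windowMean u n k) := by
  simp [windowMean]

theorem AlmostConverges.add {u v : ℕ → V} {a b : V} (hu : AlmostConverges u a)
    (hv : AlmostConverges v b) : AlmostConverges (fun n => u n + v n) (a + b) := by
  rw [almostConverges_iff] at *
  intro ε hε
  obtain ⟨N₁, h₁⟩ := hu (ε / 2) (by positivity)
  obtain ⟨N₂, h₂⟩ := hv (ε / 2) (by positivity)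
  refine ⟨max N₁ N₂, fun n hn k => ?_⟩
  rw [windowMean_add, add_sub_add_comm]
  linarith [norm_add_le (windowMean u n k - a) (windowMean v n k - b),
    h₁ n (le_of_max_le_left hn) k, h₂ n (le_of_max_le_right hn) k]

theorem almostConverges_const (a : V) : AlmostConverges (fun _ => a) a := by
  rw [almostConverges_iff]
  exact fun ε hε => ⟨0, fun n _ k => by rwa [windowMean_const, sub_self, norm_zero]⟩

/-- Sequences dominated by a multiple of an almost null sequence are almost null. -/
theorem AlmostConverges.of_norm_le {u : ℕ → V} {a : ℕ → ℝ} {C : ℝ} (ha : AlmostConverges a 0)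
    (h : ∀ i, ‖u i‖ ≤ C * a i) : AlmostConverges u 0 := by
  rw [almostConverges_iff] at *
  intro ε hε
  obtain ⟨N, hN⟩ := ha (ε / (|C| + 1)) (by positivity)
  refine ⟨N, fun n hn k => ?_⟩
  have h1 := hN n hn k
  rw [sub_zero, lt_div_iff₀ (by positivity)] at h1
  rw [sub_zero]
  have h2 : windowMean (fun i => C * a i) n k = C * windowMean a n k :=
    windowMean_map (LinearMap.mulLeft ℝ C) a n k
  calc _ ≤ windowMean (fun i => C * a i) n k := norm_windowMean_le h n k
    _ = C * windowMean a n k := h2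
    _ ≤ |C| * |windowMean a n k| := by rw [← abs_mul]; exact le_abs_self _
    _ ≤ ‖windowMean a n k‖ * (|C| + 1) := by
        rw [Real.norm_eq_abs]; nlinarith [abs_nonneg (windowMean a n k)]
    _ < ε := h1

theorem AlmostConverges.tendsto {u : ℕ → V} {a : V} (h : AlmostConverges u a) (k : ℕ) :
    Tendsto (fun n => windowMean u n k) atTop (𝓝 a) :=
  ((almostConverges_def u a).1 h).tendsto_at k

theorem AlmostConverges.tendsto_prod {u : ℕ → V} {a : V} (h : AlmostConverges u a) :
    Tendsto (fun q : ℕ × ℕ => windowMean u q.1 q.2) (atTop ×ˢ ⊤) (𝓝 a) := by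
  rw [almostConverges_def, tendstoUniformly_iff_tendsto] at h
  rw [Uniform.tendsto_nhds_right]
  exact h

theorem almostConverges_of_tendsto_prod {u : ℕ → V} {a : V}
    (h : Tendsto (fun q : ℕ × ℕ => windowMean u q.1 q.2) (atTop ×ˢ ⊤) (𝓝 a)) :
    AlmostConverges u a := by
  rw [almostConverges_def, tendstoUniformly_iff_tendsto]
  rw [Uniform.tendsto_nhds_right] at h
  exact h

/-- By uniformity, one window length serves for all starting points, and a nonnegative term is at
most the sum of its window. -/
theorem AlmostConverges.exists_bound {a : ℕ → ℝ} (ha : AlmostConverges a 0) (h0 : ∀ n, 0 ≤ a n) :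
    ∃ B, ∀ n, a n ≤ B := by
  obtain ⟨N, hN⟩ := almostConverges_iff.1 ha 1 one_pos
  refine ⟨N + 1, fun k => ?_⟩
  have h1 := (le_abs_self _).trans_lt (hN N le_rfl k)
  rw [sub_zero, windowMean, smul_eq_mul, inv_mul_lt_iff₀ (by positivity), mul_one] at h1
  have h2 := Finset.single_le_sum (f := fun j => a (k + j)) (fun i _ => h0 _)
    (Finset.mem_range.2 N.succ_pos)
  simp only [add_zero] at h2
  linarith

theorem AlmostConverges.exists_lt {a : ℕ → ℝ} (ha : AlmostConverges a 0) {ε : ℝ} (hε : 0 < ε) :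
    ∃ N, ∀ k, ∃ j ≤ N, a (k + j) < ε := by
  obtain ⟨N, hN⟩ := almostConverges_iff.1 ha ε hε
  refine ⟨N, fun k => ?_⟩
  have h1 := (le_abs_self _).trans_lt (hN N le_rfl k)
  rw [sub_zero, windowMean, smul_eq_mul, inv_mul_lt_iff₀ (by positivity)] at h1
  have h2 : ∑ j ∈ Finset.range (N + 1), a (k + j) < ∑ j ∈ Finset.range (N + 1), ε := by
    rw [Finset.sum_const, Finset.card_range, nsmul_eq_mul]
    push_cast
    exact h1
  obtain ⟨j, hj, hj'⟩ := Finset.exists_lt_of_sum_lt h2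
  exact ⟨j, by simpa [Nat.lt_succ_iff] using hj, hj'⟩

theorem AlmostConverges.shift {u : ℕ → V} {a : V} (h : AlmostConverges u a) (m : ℕ) :
    AlmostConverges (fun n => u (m + n)) a := by
  rw [almostConverges_iff] at *
  intro ε hε
  obtain ⟨N, hN⟩ := h ε hε
  refine ⟨N, fun n hn k => ?_⟩
  have : windowMean (fun n => u (m + n)) n k = windowMean u n (m + k) := by
    simp [windowMean, add_assoc]
  rw [this]
  exact hN n hn _

end AlmostConvergence

/-! ### Regular gauges -/

section Gauge

variable {p : ℕ → ℝ} {c : ℝ}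

theorem IsRegularGauge.quotient_pos (hp : IsRegularGauge p c) (n : ℕ) : 0 < c ^ n / p n :=
  div_pos (pow_pos hp.const_pos n) (hp.pos n)

theorem IsRegularGauge.exists_upper (hp : IsRegularGauge p c) : ∃ B, ∀ n, c ^ n / p n ≤ B := by
  obtain ⟨B, hB⟩ := AlmostConverges.exists_bound hp.regular fun _ => abs_nonneg _
  exact ⟨B + 1, fun n => by linarith [hB n, le_abs_self (c ^ n / p n - 1)]⟩

/-- Every window of a fixed length contains an index where `cⁿ / p n` exceeds `1/2`. Bounded ratios
`p (n + 1) / p n` limit the decay from there to `n` by a factor `K` per step. Indices below the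
window length are reached from `0`. This yields power boundedness of `T / c`. -/
theorem IsRegularGauge.exists_lower (hp : IsRegularGauge p c) :
    ∃ b > 0, ∀ n, b ≤ c ^ n / p n := by
  obtain ⟨B, hB⟩ := AlmostConverges.exists_bound hp.ratio fun _ => abs_nonneg _
  obtain ⟨N, hN⟩ := AlmostConverges.exists_lt hp.regular one_half_pos
  set s := fun n => c ^ n / p n with hs
  have hs0 : ∀ n, 0 < s n := hp.quotient_pos
  set K := max 1 ((B + c) / c) with hK
  have hK1 : 1 ≤ K := le_max_left _ _
  have hstep : ∀ n, s n ≤ K * s (n + 1) := fun n => by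
    have h1 : p (n + 1) / p n ≤ B + c := by linarith [hB n, le_abs_self (p (n + 1) / p n - c)]
    have h2 : s n = (p (n + 1) / p n / c) * s (n + 1) := by
      have := (hp.pos n).ne'
      have := (hp.pos (n + 1)).ne'
      have := hp.const_pos.ne'
      simp only [hs, pow_succ]
      field_simp
    rw [h2]
    gcongr
    · exact (hs0 _).le
    · exact (div_le_div_of_nonneg_right h1 hp.const_pos.le).trans (le_max_right _ _)
  have hsteps : ∀ n j, s n ≤ K ^ j * s (n + j) := by
    intro n j
    induction j with
    | zero => simp
    | succ j ih =>
      calc s n ≤ K ^ j * s (n + j) := ih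
        _ ≤ K ^ j * (K * s (n + j + 1)) := by gcongr; exact hstep _
        _ = _ := by ring_nf
  refine ⟨min (1 / 2) (s 0) / K ^ N, div_pos (lt_min one_half_pos (hs0 0)) (by positivity),
    fun n => ?_⟩
  rw [div_le_iff₀ (by positivity), mul_comm]
  rcases le_total N n with h | h
  · obtain ⟨j, hj, hj'⟩ := hN (n - N)
    have h1 : 1 / 2 ≤ s (n - N + j) := by
      have := (abs_lt.1 hj').1
      simp only [hs]
      linarith
    have h2 := hsteps (n - N + j) (N - j)
    rw [show n - N + j + (N - j) = n by omega] at h2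
    calc _ ≤ 1 / 2 := min_le_left _ _
      _ ≤ _ := h1.trans h2
      _ ≤ K ^ N * s n := by
        gcongr
        · exact (hs0 _).le
        · omega
  · have h2 := hsteps 0 n
    rw [zero_add] at h2
    calc _ ≤ s 0 := min_le_right _ _
      _ ≤ _ := h2
      _ ≤ K ^ N * s n := by
        gcongr
        exact (hs0 _).le

/-- The sum of two shifts of the almost null sequence is almost null, so it is small somewhere, and
there both shifts are small. Shifting by `1` and `2` ensures `n ≥ 1`, the range where domination
applies. -/
theorem IsRegularGauge.exists_consecutive (hp : IsRegularGauge p c) {ε : ℝ} (hε : 0 < ε) :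
    ∃ n ≥ 1, (p n / c ^ n) ^ 2 ≤ 1 + ε ∧ (p (n + 1) / c ^ (n + 1)) ^ 2 ≤ 1 + ε := by
  have ha : AlmostConverges (fun n => |c ^ n / p n - 1|) 0 := hp.regular
  have hsum : AlmostConverges (fun n => |c ^ (1 + n) / p (1 + n) - 1| +
      |c ^ (2 + n) / p (2 + n) - 1|) 0 := by
    simpa only [add_zero] using (ha.shift 1).add (ha.shift 2)
  -- Chosen so that `(1 - δ)² ≥ 1 - 2δ = (1 + ε)⁻¹`.
  set δ := ε / (2 * (1 + ε)) with hδ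
  have hδ0 : 0 < δ := by positivity
  have hδε : δ * (2 * (1 + ε)) = ε := div_mul_cancel₀ _ (by positivity)
  have hδ1 : δ < 1 := by nlinarith
  have key : ∀ n, |c ^ n / p n - 1| < δ → (p n / c ^ n) ^ 2 ≤ 1 + ε := fun n hn => by
    have h1 : 1 - δ < c ^ n / p n := by linarith [(abs_lt.1 hn).1]
    rw [← inv_div, inv_pow, inv_le_comm₀ (pow_pos (hp.quotient_pos n) 2) (by positivity)]
    calc (1 + ε)⁻¹ ≤ (1 - δ) ^ 2 := by
          rw [inv_le_iff_one_le_mul₀ (by positivity)]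
          nlinarith [sq_nonneg δ]
      _ ≤ _ := by
          have : 0 ≤ 1 - δ := by linarith
          gcongr
  obtain ⟨N, hN⟩ := hsum.exists_lt hδ0
  obtain ⟨j, -, hj⟩ := hN 0
  rw [zero_add] at hj
  refine ⟨1 + j, by omega, key _ ?_, ?_⟩
  · linarith [abs_nonneg (c ^ (2 + j) / p (2 + j) - 1)]
  · rw [show 1 + j + 1 = 2 + j by omega]
    exact key _ (by linarith [abs_nonneg (c ^ (1 + j) / p (1 + j) - 1)])

/-- Multiplying a bounded sequence by the squares of the quotients `cⁿ / p(n)` does not change its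
almost limit. -/
theorem IsRegularGauge.almostConverges_smul_iff (hp : IsRegularGauge p c) {V : Type*}
    [NormedAddCommGroup V] [NormedSpace ℝ V] {u : ℕ → V} {C : ℝ} (hu : ∀ n, ‖u n‖ ≤ C) {a : V} :
    AlmostConverges (fun n => (c ^ n / p n) ^ 2 • u n) a ↔ AlmostConverges u a := by
  obtain ⟨B, hB⟩ := hp.exists_upper
  have hdiff : ∀ n, ‖((c ^ n / p n) ^ 2 - 1) • u n‖ ≤ ((B + 1) * C) * |c ^ n / p n - 1| := by
    intro n
    have h0 := hp.quotient_pos n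
    have h1 : ‖(c ^ n / p n) ^ 2 - 1‖ ≤ (B + 1) * |c ^ n / p n - 1| := by
      rw [show (c ^ n / p n) ^ 2 - 1 = (c ^ n / p n + 1) * (c ^ n / p n - 1) by ring, norm_mul,
        Real.norm_eq_abs, Real.norm_eq_abs, abs_of_pos (by linarith)]
      gcongr
      exact hB n
    rw [norm_smul]
    calc _ ≤ (B + 1) * |c ^ n / p n - 1| * C := by
          gcongr
          · exact (norm_nonneg _).trans h1
          · exact hu n
      _ = _ := by ring
  constructor
  · intro h
    have := h.add (AlmostConverges.of_norm_le (u := fun n => -(((c ^ n / p n) ^ 2 - 1) • u n))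
      hp.regular fun n => by rw [norm_neg]; exact hdiff n)
    simpa [sub_smul] using this
  · intro h
    have := h.add (AlmostConverges.of_norm_le hp.regular hdiff)
    simpa [sub_smul] using this

end Gauge

/-! ### A mean ergodic theorem -/

section Ergodic

variable {K : Type*} [NormedAddCommGroup K] [InnerProductSpace ℂ K] [CompleteSpace K]

/-- The fixed space of a bounded operator. -/
def fixedSpace {K : Type*} [NormedAddCommGroup K] [InnerProductSpace ℂ K] (Ψ : K →L[ℂ] K) :
    Submodule ℂ K := (1 - Ψ).ker

theorem mem_fixedSpace {K : Type*} [NormedAddCommGroup K] [InnerProductSpace ℂ K] {Ψ : K →L[ℂ] K}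
    {ξ : K} : ξ ∈ fixedSpace Ψ ↔ Ψ ξ = ξ := by
  rw [fixedSpace, LinearMap.mem_ker]
  exact sub_eq_zero.trans eq_comm

instance (Ψ : K →L[ℂ] K) : CompleteSpace (fixedSpace Ψ) :=
  (1 - Ψ).isClosed_ker.completeSpace_coe

theorem pow_apply_of_fixed {K : Type*} [NormedAddCommGroup K] [InnerProductSpace ℂ K] {Ψ : K →L[ℂ] K} {ξ : K} (h : Ψ ξ = ξ) (n : ℕ) : (Ψ ^ n) ξ = ξ := by
  induction n with
  | zero => rfl
  | succ n ih => rw [pow_succ]; exact (congrArg _ h).trans ih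

/-- Since `⟨ξ, Ψⁿ ξ⟩ = ‖ξ‖²`, a near-contractive power satisfies `‖Ψⁿ ξ - ξ‖² ≤ ((1 + ε)² - 1)
‖ξ‖²`. Two consecutive such exponents give `Ψ ξ ≈ Ψⁿ⁺¹ ξ ≈ ξ`, so contractivity of `Ψ` itself is not
needed. -/
theorem fixed_of_adjoint_fixed {Ψ : K →L[ℂ] K}
    (hgood : ∀ ε > 0, ∃ n, (∀ ξ, ‖(Ψ ^ n) ξ‖ ≤ (1 + ε) * ‖ξ‖) ∧
      ∀ ξ, ‖(Ψ ^ (n + 1)) ξ‖ ≤ (1 + ε) * ‖ξ‖)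
    {ξ : K} (hξ : ContinuousLinearMap.adjoint Ψ ξ = ξ) : Ψ ξ = ξ := by
  have hinner : ∀ n, inner ℂ ξ ((Ψ ^ n) ξ) = inner ℂ ξ ξ := by
    intro n
    induction n with
    | zero => rfl
    | succ n ih =>
      rw [pow_succ']
      change inner ℂ ξ (Ψ ((Ψ ^ n) ξ)) = _
      rw [← ContinuousLinearMap.adjoint_inner_left, hξ, ih]
  have hsq : ∀ n ε, 0 < ε → ε ≤ 1 → ‖(Ψ ^ n) ξ‖ ≤ (1 + ε) * ‖ξ‖ →
      ‖(Ψ ^ n) ξ - ξ‖ ^ 2 ≤ 3 * ε * ‖ξ‖ ^ 2 := by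
    intro n ε hε hε1 h
    have h1 : ‖(Ψ ^ n) ξ‖ ^ 2 ≤ ((1 + ε) * ‖ξ‖) ^ 2 := by gcongr
    rw [norm_sub_sq (𝕜 := ℂ), ← inner_re_symm, hinner, inner_self_eq_norm_sq]
    nlinarith [sq_nonneg ‖ξ‖, mul_nonneg hε.le (sq_nonneg ‖ξ‖)]
  have hclose : ∀ δ > 0, ‖Ψ ξ - ξ‖ ≤ (‖Ψ‖ + 1) * δ := by
    intro δ hδ
    set ε := min 1 (δ ^ 2 / (3 * (‖ξ‖ ^ 2 + 1))) with hε
    have hε0 : 0 < ε := lt_min one_pos (by positivity)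
    have hε2 : 3 * ε * ‖ξ‖ ^ 2 ≤ δ ^ 2 := by
      have h1 : ε ≤ δ ^ 2 / (3 * (‖ξ‖ ^ 2 + 1)) := min_le_right _ _
      rw [le_div_iff₀ (by positivity)] at h1
      nlinarith
    obtain ⟨n, h1, h2⟩ := hgood ε hε0
    have h3 := abs_le_of_sq_le_sq' ((hsq n ε hε0 (min_le_left _ _) (h1 ξ)).trans hε2) hδ.le
    have h4 := abs_le_of_sq_le_sq' ((hsq (n + 1) ε hε0 (min_le_left _ _) (h2 ξ)).trans hε2) hδ.le
    have h5 : ‖(Ψ ^ (n + 1)) ξ - Ψ ξ‖ ≤ ‖Ψ‖ * δ := by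
      rw [pow_succ']
      change ‖Ψ ((Ψ ^ n) ξ) - Ψ ξ‖ ≤ _
      rw [← map_sub]
      exact (Ψ.le_opNorm _).trans (by gcongr; exact h3.2)
    calc ‖Ψ ξ - ξ‖ = ‖((Ψ ^ (n + 1)) ξ - ξ) - ((Ψ ^ (n + 1)) ξ - Ψ ξ)‖ := by congr 1; abel
      _ ≤ δ + ‖Ψ‖ * δ := (norm_sub_le _ _).trans (add_le_add h4.2 h5)
      _ = _ := by ring
  have h0 : ‖Ψ ξ - ξ‖ ≤ 0 := by
    refine le_of_forall_pos_le_add fun δ hδ => ?_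
    have := hclose (δ / (‖Ψ‖ + 1)) (by positivity)
    rwa [mul_div_cancel₀ _ (by positivity), ← zero_add δ] at this
  exact sub_eq_zero.1 (norm_le_zero_iff.1 h0)

/-- Mean ergodic theorem: the powers of a power bounded operator which is nearly contractive at
pairs of consecutive exponents almost converge to the orthogonal projection on its fixed space. -/
theorem almostConverges_pow {Ψ : K →L[ℂ] K} {C : ℝ} (hC : ∀ n ξ, ‖(Ψ ^ n) ξ‖ ≤ C * ‖ξ‖)
    (hgood : ∀ ε > 0, ∃ n, (∀ ξ, ‖(Ψ ^ n) ξ‖ ≤ (1 + ε) * ‖ξ‖) ∧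
      ∀ ξ, ‖(Ψ ^ (n + 1)) ξ‖ ≤ (1 + ε) * ‖ξ‖) (ξ : K) :
    AlmostConverges (fun n => (Ψ ^ n) ξ) ((fixedSpace Ψ).starProjection ξ) := by
  set U := fixedSpace Ψ
  set R : Submodule ℂ K := (1 - Ψ).range
  -- A vector orthogonal to the range of `1 - Ψ` is fixed by the adjoint, hence by `Ψ`. So `Uᗮ` lies
  -- in the closure of that range, where averages telescope.
  have hRU : Rᗮ ≤ U := by
    intro ζ hζ
    rw [mem_fixedSpace]
    refine fixed_of_adjoint_fixed hgood ?_
    refine ext_inner_right ℂ fun η => ?_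
    have h1 : inner ℂ ((1 - Ψ) η) ζ = 0 := Submodule.inner_right_of_mem_orthogonal (K := R) (LinearMap.mem_range_self _ η) hζ
    have h2 : inner ℂ ζ (η - Ψ η) = 0 := inner_eq_zero_symm.1 h1
    rw [inner_sub_right, sub_eq_zero] at h2
    rw [ContinuousLinearMap.adjoint_inner_left, h2]
  have hnull : ∀ ζ ∈ Uᗮ, AlmostConverges (fun n => (Ψ ^ n) ζ) 0 := by
    intro ζ hζ
    have hζ' : ζ ∈ R.topologicalClosure := by
      rw [← Submodule.orthogonal_orthogonal_eq_closure]
      exact Submodule.orthogonal_le hRU hζ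
    have hζ'' : ζ ∈ closure (R : Set K) := hζ'
    rw [almostConverges_iff]
    intro ε hε
    obtain ⟨_, ⟨θ, rfl⟩, hθ⟩ := Metric.mem_closure_iff.1 hζ'' (ε / 2 / (|C| + 1)) (by positivity)
    obtain ⟨N, hN⟩ := exists_nat_gt (2 * (|C| * ‖θ‖) / (ε / 2))
    refine ⟨N, fun n hn k => ?_⟩
    have hC' : ∀ n ξ, ‖(Ψ ^ n) ξ‖ ≤ |C| * ‖ξ‖ := fun n ξ =>
      (hC n ξ).trans (by gcongr; exact le_abs_self C)
    have hsplit : windowMean (fun i => (Ψ ^ i) ζ) n k =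
        windowMean (fun i => (Ψ ^ i) (ζ - (1 - Ψ) θ)) n k +
        windowMean (fun i => (Ψ ^ i) ((1 - Ψ) θ)) n k := by
      rw [← windowMean_add]
      simp only [← map_add, sub_add_cancel]
    have h1 : ‖windowMean (fun i => (Ψ ^ i) (ζ - (1 - Ψ) θ)) n k‖ ≤ ε / 2 := by
      refine norm_windowMean_le_const (fun i => (hC' i _).trans ?_) n k
      have hθ' : ‖ζ - (1 - Ψ) θ‖ < ε / 2 / (|C| + 1) := by rw [← dist_eq_norm]; exact hθ
      rw [lt_div_iff₀ (by positivity)] at hθ'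
      nlinarith [norm_nonneg (ζ - (1 - Ψ) θ)]
    have htel : ∑ j ∈ Finset.range (n + 1), (Ψ ^ (k + j)) ((1 - Ψ) θ) =
        (Ψ ^ k) θ - (Ψ ^ (k + (n + 1))) θ := by
      have := Finset.sum_range_sub' (fun j => (Ψ ^ (k + j)) θ) (n + 1)
      rw [add_zero] at this
      rw [← this]
      refine Finset.sum_congr rfl fun j _ => ?_
      rw [← add_assoc, pow_succ Ψ (k + j)]
      simp
    have h2 : ‖windowMean (fun i => (Ψ ^ i) ((1 - Ψ) θ)) n k‖ < ε / 2 := by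
      rw [windowMean, htel, norm_smul, Real.norm_of_nonneg (by positivity),
        inv_mul_lt_iff₀ (by positivity)]
      have hn' : (N : ℝ) ≤ n := by exact_mod_cast hn
      rw [div_lt_iff₀ (by positivity)] at hN
      calc _ ≤ |C| * ‖θ‖ + |C| * ‖θ‖ :=
            (norm_sub_le _ _).trans (add_le_add (hC' _ _) (hC' _ _))
        _ = 2 * (|C| * ‖θ‖) := by ring
        _ < N * (ε / 2) := hN
        _ ≤ (n + 1) * (ε / 2) := by gcongr; linarith
    rw [sub_zero, hsplit]
    linarith [norm_add_le (windowMean (fun i => (Ψ ^ i) (ζ - (1 - Ψ) θ)) n k)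
      (windowMean (fun i => (Ψ ^ i) ((1 - Ψ) θ)) n k)]
  have hfix : Ψ (U.starProjection ξ) = U.starProjection ξ :=
    mem_fixedSpace.1 (Submodule.starProjection_apply_mem U ξ)
  have h := (almostConverges_const (U.starProjection ξ)).add
    (hnull (ξ - U.starProjection ξ) (Submodule.sub_starProjection_mem_orthogonal ξ))
  rw [add_zero] at h
  refine Eq.mp ?_ h
  congr 1
  funext n
  rw [map_sub, pow_apply_of_fixed hfix]
  abel

/-- The projection on the fixed space commutes with the commutant of the operator. -/
theorem starProjection_fixedSpace_comm {Ψ R : K →L[ℂ] K} {C : ℝ}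
    (hC : ∀ n ξ, ‖(Ψ ^ n) ξ‖ ≤ C * ‖ξ‖)
    (hgood : ∀ ε > 0, ∃ n, (∀ ξ, ‖(Ψ ^ n) ξ‖ ≤ (1 + ε) * ‖ξ‖) ∧
      ∀ ξ, ‖(Ψ ^ (n + 1)) ξ‖ ≤ (1 + ε) * ‖ξ‖) (hR : Commute Ψ R) (ξ : K) :
    (fixedSpace Ψ).starProjection (R ξ) = R ((fixedSpace Ψ).starProjection ξ) := by
  have h1 := (almostConverges_pow hC hgood (R ξ)).tendsto 0
  have h2 := (R.continuous.tendsto _).comp ((almostConverges_pow hC hgood ξ).tendsto 0)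
  refine tendsto_nhds_unique h1 (h2.congr fun n => ?_)
  refine (windowMean_map (R.toLinearMap.restrictScalars ℝ) _ n 0).symm.trans ?_
  congr 1
  funext i
  exact congrArg (fun f : K →L[ℂ] K => f ξ) (hR.pow_left i).eq.symm

end Ergodic

/-! ### The operator associated with a dominated element -/

/-- A bounded family of elements of `M` converging in `L²` converges weak*, to an element of `M`. -/
theorem exists_limit_of_tendsto_toL2 (hτ : IsFaithfulNormalTrace M τ) {ι : Type*} {F : Filter ι}
    [F.NeBot] {A : ι → Elem M} {C : ℝ} (hA : ∀ i, ‖A i‖ ≤ C) {ζ : L2 hτ}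
    (h : Tendsto (fun i => toL2 hτ (A i)) F (𝓝 ζ)) :
    ∃ B : Elem M, ‖B‖ ≤ C ∧ toL2 hτ B = ζ ∧
      ∀ l : Elem M →ₗ[ℂ] ℂ, IsNormal M l → Tendsto (fun i => l (A i)) F (𝓝 (l B)) := by
  have hX : ∀ X, Tendsto (fun i => τ (X * A i)) F (𝓝 (inner ℂ (toL2 hτ (star X)) ζ)) := fun X => by
    simp only [trace_mul_eq_inner hτ]
    exact tendsto_const_nhds.inner h
  obtain ⟨B, hB, hl⟩ := hτ.exists_limit A C hA fun X => ⟨_, hX X⟩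
  refine ⟨B, hB, ?_, hl⟩
  refine (denseRange_toL2 hτ).eq_of_inner_right ℂ ?_
  intro X
  rw [← star_star X, ← trace_mul_eq_inner]
  exact tendsto_nhds_unique (hl _ (hτ.normal.mul_left (star X))) (hX (star X))

theorem isPositive_iff_vectorFunctional {A : Elem M} : (A : H →L[ℂ] H).IsPositive ↔
    ∀ x, 0 ≤ (vectorFunctional M x x A).re ∧ (vectorFunctional M x x A).im = 0 := by
  rw [ContinuousLinearMap.isPositive_iff_complex]
  refine forall_congr' fun x => ?_
  rw [vectorFunctional_apply, ← inner_conj_symm x]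
  simp only [RCLike.re_eq_complex_re, Complex.conj_re, Complex.conj_im, neg_eq_zero]
  constructor
  · rintro ⟨h1, h2⟩
    exact ⟨h2, by rw [← h1, Complex.ofReal_im]⟩
  · rintro ⟨h1, h2⟩
    exact ⟨Complex.ext (Complex.ofReal_re _) (by rw [Complex.ofReal_im, h2]), h1⟩

theorem isPositive_of_tendsto {ι : Type*} {F : Filter ι} [F.NeBot] {A : ι → Elem M} {B : Elem M}
    (hA : ∀ᶠ i in F, (A i : H →L[ℂ] H).IsPositive)
    (h : ∀ l : Elem M →ₗ[ℂ] ℂ, IsNormal M l → Tendsto (fun i => l (A i)) F (𝓝 (l B))) :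
    (B : H →L[ℂ] H).IsPositive := by
  rw [isPositive_iff_vectorFunctional]
  intro x
  have hx := h _ (isNormal_vectorFunctional x x)
  constructor
  · exact ge_of_tendsto ((Complex.continuous_re.tendsto _).comp hx)
      (hA.mono fun i hi => (isPositive_iff_vectorFunctional.1 hi x).1)
  · exact tendsto_nhds_unique ((Complex.continuous_im.tendsto _).comp hx)
      (tendsto_const_nhds.congr' (hA.mono fun i hi =>
        (isPositive_iff_vectorFunctional.1 hi x).2.symm))

theorem isPositive_windowMean {u : ℕ → Elem M} (hu : ∀ i, (u i : H →L[ℂ] H).IsPositive) (n k : ℕ) :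
    ((windowMean u n k : Elem M) : H →L[ℂ] H).IsPositive := by
  rw [isPositive_iff_vectorFunctional]
  intro x
  have h : vectorFunctional M x x (windowMean u n k) =
      windowMean (fun i => vectorFunctional M x x (u i)) n k :=
    (windowMean_map ((vectorFunctional M x x).toLinearMap.restrictScalars ℝ) u n k).symm
  rw [h]
  constructor
  · rw [← Complex.reLm_coe, ← windowMean_map]
    exact mul_nonneg (by positivity) (Finset.sum_nonneg fun i _ =>
      (isPositive_iff_vectorFunctional.1 (hu _) x).1)
  · rw [← Complex.imLm_coe, ← windowMean_map]
    have : (fun i => Complex.imLm (vectorFunctional M x x (u i))) = fun _ => 0 :=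
      funext fun i => (isPositive_iff_vectorFunctional.1 (hu i) x).2
    rw [this, windowMean_const]

theorem isPositive_conj {X : Elem M} (hX : (X : H →L[ℂ] H).IsPositive) (A : Elem M) :
    ((star A * X * A : Elem M) : H →L[ℂ] H).IsPositive := by
  rw [isPositive_iff_vectorFunctional]
  intro x
  have h : vectorFunctional M x x (star A * X * A) =
      vectorFunctional M ((A : H →L[ℂ] H) x) ((A : H →L[ℂ] H) x) X :=
    ContinuousLinearMap.adjoint_inner_right _ _ _
  rw [h]
  exact isPositive_iff_vectorFunctional.1 hX _

/-- Positive contractive `τ`-symmetric idempotents on `M`. -/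
structure IsTraceProjection (τ : Elem M →ₗ[ℂ] ℂ) (φ : Elem M →L[ℂ] Elem M) : Prop where
  symm : ∀ X Y, τ (X * φ Y) = τ (φ X * Y)
  idem : ∀ X, φ (φ X) = φ X
  star_map : ∀ X, φ (star X) = star (φ X)
  norm_le : ∀ X, ‖φ X‖ ≤ ‖X‖
  pos : ∀ X : Elem M, (X : H →L[ℂ] H).IsPositive → (φ X : H →L[ℂ] H).IsPositive

/-- Only an inequality, since `H` may be trivial. -/
theorem norm_one_elem_le : ‖(1 : Elem M)‖ ≤ 1 := ContinuousLinearMap.norm_id_le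

/-- The normalisation `T / c`. -/
def normalized (c : ℝ) (T : Elem M) : Elem M := ((c : ℂ)⁻¹) • T

section Dominated

variable {p : ℕ → ℝ} {c : ℝ} {T : Elem M}

theorem norm_normalized_pow_le (hp : IsRegularGauge p c) (hT : IsDominatedBy M T p) {n : ℕ}
    (hn : 1 ≤ n) : ‖normalized c T ^ n‖ ≤ p n / c ^ n := by
  rw [normalized, smul_pow, norm_smul, norm_pow, norm_inv, Complex.norm_real,
    Real.norm_of_nonneg hp.const_pos.le, inv_pow, inv_mul_eq_div]
  exact div_le_div_of_nonneg_right (hT n hn) (pow_nonneg hp.const_pos.le n)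

theorem exists_norm_normalized_pow_le (hp : IsRegularGauge p c) (hT : IsDominatedBy M T p) :
    ∃ C, 1 ≤ C ∧ ∀ n, ‖normalized c T ^ n‖ ≤ C := by
  obtain ⟨b, hb, h⟩ := hp.exists_lower
  refine ⟨max 1 b⁻¹, le_max_left _ _, fun n => ?_⟩
  -- Domination says nothing at `n = 0`, hence the `max` with `1`.
  rcases Nat.eq_zero_or_pos n with rfl | hn
  · rw [pow_zero]
    exact norm_one_elem_le.trans (le_max_left _ _)
  · refine (norm_normalized_pow_le hp hT hn).trans (le_max_of_le_right ?_)
    rw [← inv_div]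
    exact inv_anti₀ hb (h n)

theorem conjMap_eq (hp : IsRegularGauge p c) (n : ℕ) (X : Elem M) :
    conjMap M p T n X = (c ^ n / p n) ^ 2 •
      (star (normalized c T ^ n) * X * normalized c T ^ n) := by
  have hc : (c : ℂ) ≠ 0 := Complex.ofReal_ne_zero.2 hp.const_pos.ne'
  have hT : T = (c : ℂ) • normalized c T := by rw [normalized, smul_smul, mul_inv_cancel₀ hc, one_smul]
  have h1 : star T ^ n * X * T ^ n =
      (c ^ n) ^ 2 • (star (normalized c T ^ n) * X * normalized c T ^ n) := by
    conv_lhs => rw [hT]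
    rw [star_smul, smul_pow, smul_pow, star_pow, smul_mul_assoc, smul_mul_assoc, mul_smul_comm,
      smul_smul, ← Complex.coe_smul]
    congr 1
    push_cast
    rw [RCLike.star_def, Complex.conj_ofReal]
    ring
  rw [conjMap, h1, smul_smul]
  congr 1
  field_simp

theorem conjL2_pow_bound (hτ : IsFaithfulNormalTrace M τ) (hp : IsRegularGauge p c)
    (hT : IsDominatedBy M T p) :
    ∃ C, ∀ n ξ, ‖(conjL2 hτ (normalized c T) ^ n) ξ‖ ≤ C * ‖ξ‖ := by
  obtain ⟨C, hC1, hC⟩ := exists_norm_normalized_pow_le hp hT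
  refine ⟨C ^ 2, fun n ξ => ?_⟩
  rw [conjL2_pow]
  refine (norm_conjL2_apply_le hτ _ ξ).trans ?_
  gcongr
  exact hC n

theorem conjL2_pow_good (hτ : IsFaithfulNormalTrace M τ) (hp : IsRegularGauge p c)
    (hT : IsDominatedBy M T p) : ∀ ε > 0, ∃ n,
      (∀ ξ, ‖(conjL2 hτ (normalized c T) ^ n) ξ‖ ≤ (1 + ε) * ‖ξ‖) ∧
      ∀ ξ, ‖(conjL2 hτ (normalized c T) ^ (n + 1)) ξ‖ ≤ (1 + ε) * ‖ξ‖ := by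
  intro ε hε
  obtain ⟨n, hn, h1, h2⟩ := hp.exists_consecutive hε
  refine ⟨n, fun ξ => ?_, fun ξ => ?_⟩
  · rw [conjL2_pow]
    refine (norm_conjL2_apply_le hτ _ ξ).trans ?_
    gcongr
    refine le_trans ?_ h1
    gcongr
    exact norm_normalized_pow_le hp hT hn
  · rw [conjL2_pow]
    refine (norm_conjL2_apply_le hτ _ ξ).trans ?_
    gcongr
    refine le_trans ?_ h2
    gcongr
    exact norm_normalized_pow_le hp hT (by omega)

/-- The projection of `L²` on the fixed vectors of `X ↦ V* X V`, where `V = T / c`. -/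
def fixedProj (hτ : IsFaithfulNormalTrace M τ) (c : ℝ) (T : Elem M) : L2 hτ →L[ℂ] L2 hτ :=
  (fixedSpace (conjL2 hτ (normalized c T))).starProjection

/-- The commutant property of fixed-space projections is applied twice: first to the two conjugation
operators, then to one of them and the projection of the other. -/
theorem fixedProj_comm (hτ : IsFaithfulNormalTrace M τ) (hp : IsRegularGauge p c)
    (hT : IsDominatedBy M T p) {T' : Elem M} (hT' : IsDominatedBy M T' p) (h : T * T' = T' * T)
    (ξ : L2 hτ) :
    fixedProj hτ c T (fixedProj hτ c T' ξ) = fixedProj hτ c T' (fixedProj hτ c T ξ) := by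
  obtain ⟨C, hC⟩ := conjL2_pow_bound hτ hp hT
  obtain ⟨C', hC'⟩ := conjL2_pow_bound hτ hp hT'
  have hcomm : Commute (conjL2 hτ (normalized c T)) (conjL2 hτ (normalized c T')) := by
    change _ ∘L _ = _ ∘L _
    rw [conjL2_comp, conjL2_comp]
    simp only [normalized, smul_mul_smul_comm, h]
  have h1 : Commute (conjL2 hτ (normalized c T)) (fixedProj hτ c T') := by
    ext1 ξ
    exact (starProjection_fixedSpace_comm hC' (conjL2_pow_good hτ hp hT') hcomm.symm ξ).symm
  exact starProjection_fixedSpace_comm hC (conjL2_pow_good hτ hp hT) h1 ξ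

/-- The sequence `V*ⁿ X Vⁿ`. -/
def orbit (V X : Elem M) (n : ℕ) : Elem M := star (V ^ n) * X * V ^ n

theorem toL2_orbit (hτ : IsFaithfulNormalTrace M τ) (V X : Elem M) (n : ℕ) :
    toL2 hτ (orbit V X n) = (conjL2 hτ V ^ n) (toL2 hτ X) := by
  rw [conjL2_pow, conjL2_toL2, orbit]

theorem norm_orbit_le (V X : Elem M) (n : ℕ) : ‖orbit V X n‖ ≤ ‖V ^ n‖ ^ 2 * ‖X‖ :=
  calc _ ≤ ‖star (V ^ n)‖ * ‖X‖ * ‖V ^ n‖ := norm_mul₃_le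
    _ = _ := by rw [norm_star]; ring

theorem toL2_windowMean (hτ : IsFaithfulNormalTrace M τ) (u : ℕ → Elem M) (n k : ℕ) :
    toL2 hτ (windowMean u n k) = windowMean (fun i => toL2 hτ (u i)) n k :=
  (windowMean_map ((toL2 hτ).restrictScalars ℝ) u n k).symm

theorem star_windowMean (u : ℕ → Elem M) (n k : ℕ) :
    star (windowMean u n k) = windowMean (fun i => star (u i)) n k := by
  simp [windowMean]

theorem almostConverges_toL2_orbit (hτ : IsFaithfulNormalTrace M τ) (hp : IsRegularGauge p c)
    (hT : IsDominatedBy M T p) (X : Elem M) :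
    AlmostConverges (fun n => toL2 hτ (orbit (normalized c T) X n)) (fixedProj hτ c T (toL2 hτ X)) := by
  obtain ⟨C, hC⟩ := conjL2_pow_bound hτ hp hT
  simp only [toL2_orbit]
  exact almostConverges_pow hC (conjL2_pow_good hτ hp hT) _

theorem almostConverges_toL2_conjMap (hτ : IsFaithfulNormalTrace M τ) (hp : IsRegularGauge p c)
    (hT : IsDominatedBy M T p) (X : Elem M) :
    AlmostConverges (fun n => toL2 hτ (conjMap M p T n X)) (fixedProj hτ c T (toL2 hτ X)) := by
  obtain ⟨C, hC⟩ := conjL2_pow_bound hτ hp hT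
  have h : ∀ n, toL2 hτ (conjMap M p T n X) =
      (c ^ n / p n) ^ 2 • toL2 hτ (orbit (normalized c T) X n) := fun n => by
    rw [conjMap_eq hp]
    exact ((toL2 hτ).restrictScalars ℝ).map_smul _ _
  simp only [h]
  exact (hp.almostConverges_smul_iff (C := C * ‖toL2 hτ X‖) fun n => by
    rw [toL2_orbit]; exact hC n _).2 (almostConverges_toL2_orbit hτ hp hT X)

theorem norm_conjMap_le (hp : IsRegularGauge p c) (hT : IsDominatedBy M T p) {n : ℕ} (hn : 1 ≤ n)
    (X : Elem M) : ‖conjMap M p T n X‖ ≤ ‖X‖ := by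
  have h := hp.pos n
  rw [conjMap, norm_smul, Real.norm_of_nonneg (by positivity), inv_mul_le_iff₀ (by positivity)]
  calc _ ≤ ‖star T ^ n‖ * ‖X‖ * ‖T ^ n‖ := norm_mul₃_le
    _ = ‖T ^ n‖ ^ 2 * ‖X‖ := by rw [← star_pow, norm_star]; ring
    _ ≤ _ := by gcongr; exact hT n hn

theorem exists_norm_conjMap_le (hp : IsRegularGauge p c) (hT : IsDominatedBy M T p)
    (X : Elem M) : ∃ C, ∀ n, ‖conjMap M p T n X‖ ≤ C := by
  refine ⟨max ‖X‖ ‖conjMap M p T 0 X‖, fun n => ?_⟩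
  rcases Nat.eq_zero_or_pos n with rfl | hn
  · exact le_max_right _ _
  · exact (norm_conjMap_le hp hT hn X).trans (le_max_left _ _)

/-- Existence and properties of the almost limit of the maps `X ↦ p(n)⁻² T*ⁿ X Tⁿ`. -/
theorem exists_almostLimit (hτ : IsFaithfulNormalTrace M τ) (hp : IsRegularGauge p c)
    (hT : IsDominatedBy M T p) : ∃ φ : Elem M →L[ℂ] Elem M,
      (∀ X, toL2 hτ (φ X) = fixedProj hτ c T (toL2 hτ X)) ∧
      WeaklyAlmostConverges M (conjMap M p T) φ ∧ IsTraceProjection τ φ ∧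
      ∀ X, star (normalized c T) * φ X * normalized c T = φ X := by
  have hex : ∀ X, ∃ B : Elem M, ‖B‖ ≤ ‖X‖ ∧ toL2 hτ B = fixedProj hτ c T (toL2 hτ X) := by
    intro X
    -- Averages start at exponent `1`, where the maps are contractive. This gives the bound `‖X‖`
    -- without changing the limit.
    obtain ⟨B, h1, h2, -⟩ := exists_limit_of_tendsto_toL2 hτ (F := atTop)
      (A := fun n => windowMean (fun i => conjMap M p T (1 + i) X) n 0) (C := ‖X‖)
      (fun n => norm_windowMean_le_const (fun i => norm_conjMap_le hp hT (by omega) X) n 0)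
      (ζ := fixedProj hτ c T (toL2 hτ X)) (by
        simp only [toL2_windowMean]
        exact ((almostConverges_toL2_conjMap hτ hp hT X).shift 1).tendsto 0)
    exact ⟨B, h1, h2⟩
  choose f hfn hf using hex
  let φ : Elem M →L[ℂ] Elem M := LinearMap.mkContinuous
    { toFun := f
      map_add' := fun X Y => toL2_injective hτ (by simp only [hf, map_add])
      map_smul' := fun a X => toL2_injective hτ (by simp only [hf, map_smul, RingHom.id_apply]) }
    1 fun X => by rw [one_mul]; exact hfn X
  have hφ : ∀ X, toL2 hτ (φ X) = fixedProj hτ c T (toL2 hτ X) := hf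
  have hstar : ∀ X, φ (star X) = star (φ X) := by
    intro X
    refine toL2_injective hτ ?_
    have h1 := (almostConverges_toL2_orbit hτ hp hT (star X)).tendsto 0
    have h2 := (almostConverges_toL2_orbit hτ hp hT X).tendsto 0
    rw [← hφ, ← tendsto_sub_nhds_zero_iff, tendsto_zero_iff_norm_tendsto_zero] at h1 h2
    rw [hφ] at h1
    have h3 : Tendsto (fun n => windowMean (fun i => toL2 hτ (orbit (normalized c T) (star X) i)) n 0)
        atTop (𝓝 (toL2 hτ (star (φ X)))) := by
      rw [← tendsto_sub_nhds_zero_iff, tendsto_zero_iff_norm_tendsto_zero]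
      refine h2.congr fun n => ?_
      rw [← toL2_windowMean, ← map_sub, ← norm_toL2_star, star_sub, star_windowMean, map_sub,
        toL2_windowMean]
      simp only [orbit, star_mul, star_star, mul_assoc]
    rw [hφ]
    exact tendsto_nhds_unique ((almostConverges_toL2_orbit hτ hp hT (star X)).tendsto 0) h3
  -- Trace symmetry is self-adjointness of the orthogonal projection, combined with compatibility
  -- with the involution.
  have hsymm : ∀ X Y, τ (X * φ Y) = τ (φ X * Y) := by
    intro X Y
    rw [trace_mul_eq_inner hτ, trace_mul_eq_inner hτ, hφ, ← hstar, hφ]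
    exact (Submodule.inner_starProjection_left_eq_right _ _ _).symm
  refine ⟨φ, hφ, ⟨hτ.isWeakStarContinuous hsymm, ?_⟩, ⟨hsymm, ?_, hstar, hfn, ?_⟩, ?_⟩
  · intro l hl X
    obtain ⟨C, hC⟩ := exists_norm_conjMap_le hp hT X
    -- The filter `atTop ×ˢ ⊤` encodes uniformity in the starting point, so a single weak* limit
    -- yields almost convergence.
    obtain ⟨B, -, hB, hlim⟩ := exists_limit_of_tendsto_toL2 hτ (F := atTop ×ˢ (⊤ : Filter ℕ))
      (A := fun q : ℕ × ℕ => windowMean (fun i => conjMap M p T i X) q.1 q.2) (C := C)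
      (fun q => norm_windowMean_le_const hC _ _)
      (ζ := fixedProj hτ c T (toL2 hτ X)) (by
        simp only [toL2_windowMean]
        exact (almostConverges_toL2_conjMap hτ hp hT X).tendsto_prod)
    obtain rfl : B = φ X := toL2_injective hτ (hB.trans (hφ X).symm)
    refine almostConverges_of_tendsto_prod ?_
    have h1 : ∀ q : ℕ × ℕ, windowMean (fun n => l (conjMap M p T n X - φ X)) q.1 q.2 =
        l (windowMean (fun n => conjMap M p T n X) q.1 q.2) - l (φ X) := by
      intro q
      have h2 := windowMean_map (l.restrictScalars ℝ) (fun n => conjMap M p T n X - φ X) q.1 q.2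
      refine h2.trans ?_
      simp only [sub_eq_add_neg]
      rw [windowMean_add, windowMean_const]
      simp
    simp only [h1]
    exact tendsto_sub_nhds_zero_iff.2 (hlim l hl)
  · intro X
    refine toL2_injective hτ ?_
    rw [hφ, hφ]
    exact Submodule.starProjection_eq_self_iff.2 (Submodule.starProjection_apply_mem _ _)
  · intro X hX
    obtain ⟨C, hC1, hC⟩ := exists_norm_normalized_pow_le hp hT
    obtain ⟨B, -, hB, hlim⟩ := exists_limit_of_tendsto_toL2 hτ (F := atTop)
      (A := fun n => windowMean (orbit (normalized c T) X) n 0) (C := C ^ 2 * ‖X‖)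
      (fun n => norm_windowMean_le_const (fun i => (norm_orbit_le _ _ _).trans (by
        gcongr; exact hC i)) _ _)
      (ζ := fixedProj hτ c T (toL2 hτ X)) (by
        simp only [toL2_windowMean]
        exact (almostConverges_toL2_orbit hτ hp hT X).tendsto 0)
    obtain rfl : B = φ X := toL2_injective hτ (hB.trans (hφ X).symm)
    exact isPositive_of_tendsto
      (Eventually.of_forall fun n => isPositive_windowMean (fun i => isPositive_conj hX _) n 0) hlim
  · intro X
    refine toL2_injective hτ ?_
    rw [← conjL2_toL2, hφ]
    exact mem_fixedSpace.1 (Submodule.starProjection_apply_mem _ _)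

end Dominated

/-! ### Semigroups of commuting projections as nets -/

theorem IsTraceProjection.comp {φ ψ : Elem M →L[ℂ] Elem M} (hφ : IsTraceProjection τ φ)
    (hψ : IsTraceProjection τ ψ) (h : φ * ψ = ψ * φ) : IsTraceProjection τ (φ * ψ) := by
  have h' : ∀ X, φ (ψ X) = ψ (φ X) := fun X => congrArg (fun f : Elem M →L[ℂ] Elem M => f X) h
  refine ⟨fun X Y => ?_, fun X => ?_, fun X => ?_, fun X => ?_, fun X hX => ?_⟩
  · change τ (X * φ (ψ Y)) = τ (φ (ψ X) * Y)
    rw [hφ.symm, hψ.symm, h']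
  · change φ (ψ (φ (ψ X))) = φ (ψ X)
    rw [← h' (ψ X), hψ.idem, hφ.idem]
  · change φ (ψ (star X)) = star (φ (ψ X))
    rw [hψ.star_map, hφ.star_map]
  · exact (hφ.norm_le _).trans (hψ.norm_le X)
  · exact hφ.pos _ (hψ.pos X hX)

/-- Pythagoras: a `τ`-symmetric idempotent acts on `L²` as an orthogonal projection. -/
theorem IsTraceProjection.norm_toL2_sub_sq (hτ : IsFaithfulNormalTrace M τ)
    {χ : Elem M →L[ℂ] Elem M} (hχ : IsTraceProjection τ χ) (Y : Elem M) :
    ‖toL2 hτ (χ Y) - toL2 hτ Y‖ ^ 2 = ‖toL2 hτ Y‖ ^ 2 - ‖toL2 hτ (χ Y)‖ ^ 2 := by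
  have h : inner ℂ (toL2 hτ (χ Y)) (toL2 hτ Y) = inner ℂ (toL2 hτ (χ Y)) (toL2 hτ (χ Y)) := by
    rw [inner_toL2, inner_toL2, ← hχ.star_map, hχ.symm, hχ.idem]
  rw [norm_sub_sq (𝕜 := ℂ), h, inner_self_eq_norm_sq]
  ring

/-- A commutative semigroup of trace projections. -/
structure IsProjectionSemigroup (τ : Elem M →ₗ[ℂ] ℂ) (𝒢 : Set (Elem M →L[ℂ] Elem M)) : Prop where
  nonempty : 𝒢.Nonempty
  mul_mem : ∀ φ ∈ 𝒢, ∀ ψ ∈ 𝒢, φ * ψ ∈ 𝒢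
  comm : ∀ φ ∈ 𝒢, ∀ ψ ∈ 𝒢, φ * ψ = ψ * φ
  proj : ∀ φ ∈ 𝒢, IsTraceProjection τ φ

/-- The elements of `𝒢` above `φ₀`. -/
def upperPart (𝒢 : Set (Elem M →L[ℂ] Elem M)) (φ₀ : 𝒢) : Set 𝒢 :=
  {φ | ∃ χ ∈ 𝒢, (φ : Elem M →L[ℂ] Elem M) = χ ∘L φ₀}

/-- The filter of the net formed by a semigroup indexed by itself. -/
def netFilter (𝒢 : Set (Elem M →L[ℂ] Elem M)) : Filter 𝒢 := ⨅ φ₀, 𝓟 (upperPart 𝒢 φ₀)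

namespace IsProjectionSemigroup

variable {𝒢 : Set (Elem M →L[ℂ] Elem M)}

theorem hasBasis (h𝒢 : IsProjectionSemigroup τ 𝒢) :
    (netFilter 𝒢).HasBasis (fun _ => True) (upperPart 𝒢) := by
  have : Nonempty 𝒢 := h𝒢.nonempty.to_subtype
  refine hasBasis_iInf_principal fun φ ψ => ⟨⟨φ * ψ, h𝒢.mul_mem _ φ.2 _ ψ.2⟩, ?_, ?_⟩
  · rintro θ ⟨χ, hχ, h⟩
    refine ⟨χ * ψ, h𝒢.mul_mem _ hχ _ ψ.2, h.trans ?_⟩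
    change χ * (φ * ψ : Elem M →L[ℂ] Elem M) = χ * ψ * φ
    rw [h𝒢.comm _ φ.2 _ ψ.2, mul_assoc]
  · rintro θ ⟨χ, hχ, h⟩
    exact ⟨χ * φ, h𝒢.mul_mem _ hχ _ φ.2, h⟩

theorem netFilter_neBot (h𝒢 : IsProjectionSemigroup τ 𝒢) : (netFilter 𝒢).NeBot :=
  h𝒢.hasBasis.neBot_iff.2 fun {φ} _ =>
    ⟨⟨φ * φ, h𝒢.mul_mem _ φ.2 _ φ.2⟩, φ, φ.2, rfl⟩

theorem netWeaklyConverges_iff (h𝒢 : IsProjectionSemigroup τ 𝒢) {E : Elem M →L[ℂ] Elem M} :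
    NetWeaklyConverges M 𝒢 E ↔ ∀ l : Elem M →ₗ[ℂ] ℂ, IsNormal M l → ∀ X : Elem M,
      Tendsto (fun φ : 𝒢 => l ((φ : Elem M →L[ℂ] Elem M) X)) (netFilter 𝒢) (𝓝 (l (E X))) := by
  refine forall_congr' fun l => forall_congr' fun _ => forall_congr' fun X => ?_
  rw [h𝒢.hasBasis.tendsto_iff Metric.nhds_basis_ball]
  refine forall_congr' fun ε => forall_congr' fun _ => ?_
  constructor
  · rintro ⟨φ₀, hφ₀, h⟩
    exact ⟨⟨φ₀, hφ₀⟩, trivial, fun φ hφ => by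
      rw [mem_ball_iff_norm]; exact h φ φ.2 hφ⟩
  · rintro ⟨φ₀, -, h⟩
    refine ⟨φ₀, φ₀.2, fun φ hφ hφ' => ?_⟩
    rw [← mem_ball_iff_norm]
    exact h ⟨φ, hφ⟩ hφ'

/-- Above `φ`, an element has the form `χ φ`, and `φ` is absorbed by commutativity and idempotence.
-/
theorem eventually_comp_eq (h𝒢 : IsProjectionSemigroup τ 𝒢) {φ : Elem M →L[ℂ] Elem M}
    (hφ : φ ∈ 𝒢) : ∀ᶠ ψ : 𝒢 in netFilter 𝒢, ∀ X,
      φ ((ψ : Elem M →L[ℂ] Elem M) X) = (ψ : Elem M →L[ℂ] Elem M) X := by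
  filter_upwards [h𝒢.hasBasis.mem_of_mem (i := ⟨φ, hφ⟩) trivial]
  rintro ψ ⟨χ, hχ, hψ⟩ X
  have h1 : φ (χ (φ X)) = χ (φ (φ X)) :=
    congrArg (fun f : Elem M →L[ℂ] Elem M => f (φ X)) (h𝒢.comm _ hφ _ hχ)
  rw [hψ]
  change φ (χ (φ X)) = χ (φ X)
  rw [h1, (h𝒢.proj φ hφ).idem]

/-- Squared `L²` norms decrease along the net. Past an element nearly attaining their infimum,
Pythagoras bounds the remaining displacement. -/
theorem exists_tendsto_toL2 (hτ : IsFaithfulNormalTrace M τ) (h𝒢 : IsProjectionSemigroup τ 𝒢)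
    (X : Elem M) : ∃ ζ, Tendsto (fun φ : 𝒢 => toL2 hτ ((φ : Elem M →L[ℂ] Elem M) X))
      (netFilter 𝒢) (𝓝 ζ) := by
  have := h𝒢.netFilter_neBot
  have : Nonempty 𝒢 := h𝒢.nonempty.to_subtype
  rw [← cauchy_map_iff_exists_tendsto, Metric.cauchy_iff]
  refine ⟨inferInstance, fun ε hε => ?_⟩
  let r : 𝒢 → ℝ := fun φ => ‖toL2 hτ ((φ : Elem M →L[ℂ] Elem M) X)‖ ^ 2
  have hbdd : BddBelow (Set.range r) := ⟨0, by rintro _ ⟨φ, rfl⟩; positivity⟩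
  obtain ⟨φ₀, hφ₀⟩ := exists_lt_of_ciInf_lt
    (lt_add_of_pos_right (⨅ φ, r φ) (by positivity : 0 < (ε / 2) ^ 2))
  have hclose : ∀ φ ∈ upperPart 𝒢 φ₀, dist (toL2 hτ ((φ : Elem M →L[ℂ] Elem M) X))
      (toL2 hτ ((φ₀ : Elem M →L[ℂ] Elem M) X)) < ε / 2 := by
    rintro φ ⟨χ, hχ, hφ⟩
    have h1 := (h𝒢.proj χ hχ).norm_toL2_sub_sq hτ ((φ₀ : Elem M →L[ℂ] Elem M) X)
    have h2 : χ ((φ₀ : Elem M →L[ℂ] Elem M) X) = (φ : Elem M →L[ℂ] Elem M) X := by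
      rw [hφ]; rfl
    rw [h2] at h1
    have h3 : ⨅ φ, r φ ≤ r φ := ciInf_le hbdd φ
    rw [dist_eq_norm]
    refine lt_of_pow_lt_pow_left₀ 2 (by positivity) ?_
    rw [h1]
    simp only [r] at h3 hφ₀ ⊢
    linarith
  refine ⟨_, image_mem_map (h𝒢.hasBasis.mem_of_mem (i := φ₀) trivial), ?_⟩
  rintro _ ⟨φ, hφ, rfl⟩ _ ⟨ψ, hψ, rfl⟩
  linarith [dist_triangle_right (toL2 hτ ((φ : Elem M →L[ℂ] Elem M) X))
    (toL2 hτ ((ψ : Elem M →L[ℂ] Elem M) X)) (toL2 hτ ((φ₀ : Elem M →L[ℂ] Elem M) X)),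
    hclose φ hφ, hclose ψ hψ]

/-- The net formed by a commutative semigroup of trace projections has a weak limit. -/
theorem exists_limit (hτ : IsFaithfulNormalTrace M τ) (h𝒢 : IsProjectionSemigroup τ 𝒢) :
    ∃ E : Elem M →L[ℂ] Elem M, NetWeaklyConverges M 𝒢 E := by
  have := h𝒢.netFilter_neBot
  choose ζ hζ using h𝒢.exists_tendsto_toL2 hτ
  have hex : ∀ X, _ := fun X => exists_limit_of_tendsto_toL2 hτ
    (fun φ : 𝒢 => (h𝒢.proj φ φ.2).norm_le X) (hζ X)
  choose f hfn hf hlim using hex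
  let E : Elem M →L[ℂ] Elem M := LinearMap.mkContinuous
    { toFun := f
      map_add' := fun X Y => toL2_injective hτ <| by
        rw [map_add, hf, hf, hf]
        refine tendsto_nhds_unique (hζ (X + Y)) ?_
        simpa only [map_add] using (hζ X).add (hζ Y)
      map_smul' := fun a X => toL2_injective hτ <| by
        rw [RingHom.id_apply, map_smul, hf, hf]
        refine tendsto_nhds_unique (hζ (a • X)) ?_
        simpa only [map_smul] using (hζ X).const_smul a }
    1 fun X => by rw [one_mul]; exact hfn X
  exact ⟨E, h𝒢.netWeaklyConverges_iff.2 fun l hl X => hlim X l hl⟩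

/-! ### Properties of the limit operator -/

section Limit

variable {E : Elem M →L[ℂ] Elem M}

theorem limit_unique (hτ : IsFaithfulNormalTrace M τ) (h𝒢 : IsProjectionSemigroup τ 𝒢)
    (hE : NetWeaklyConverges M 𝒢 E) {E' : Elem M →L[ℂ] Elem M}
    (hE' : NetWeaklyConverges M 𝒢 E') : E = E' := by
  have := h𝒢.netFilter_neBot
  ext1 X
  exact hτ.eq_of_forall fun Y => tendsto_nhds_unique
    (h𝒢.netWeaklyConverges_iff.1 hE _ (hτ.normal.mul_left Y) X)
    (h𝒢.netWeaklyConverges_iff.1 hE' _ (hτ.normal.mul_left Y) X)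

theorem tendsto_trace (hτ : IsFaithfulNormalTrace M τ) (h𝒢 : IsProjectionSemigroup τ 𝒢)
    (hE : NetWeaklyConverges M 𝒢 E) (X Y : Elem M) :
    Tendsto (fun φ : 𝒢 => τ (X * (φ : Elem M →L[ℂ] Elem M) Y)) (netFilter 𝒢) (𝓝 (τ (X * E Y))) :=
  h𝒢.netWeaklyConverges_iff.1 hE _ (hτ.normal.mul_left X) Y

theorem limit_symm (hτ : IsFaithfulNormalTrace M τ) (h𝒢 : IsProjectionSemigroup τ 𝒢)
    (hE : NetWeaklyConverges M 𝒢 E) (X Y : Elem M) : τ (X * E Y) = τ (E X * Y) := by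
  have := h𝒢.netFilter_neBot
  rw [hτ.trace (E X)]
  refine tendsto_nhds_unique (h𝒢.tendsto_trace hτ hE X Y)
    ((h𝒢.tendsto_trace hτ hE Y X).congr fun φ => ?_)
  rw [hτ.trace, (h𝒢.proj φ φ.2).symm]

/-- Moving `φ` across the trace by symmetry reduces the claim to elements far along the net, which
eventually absorb `φ`. -/
theorem apply_limit (hτ : IsFaithfulNormalTrace M τ) (h𝒢 : IsProjectionSemigroup τ 𝒢)
    (hE : NetWeaklyConverges M 𝒢 E) {φ : Elem M →L[ℂ] Elem M} (hφ : φ ∈ 𝒢) (X : Elem M) :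
    φ (E X) = E X := by
  have := h𝒢.netFilter_neBot
  refine hτ.eq_of_forall fun Y => ?_
  rw [(h𝒢.proj φ hφ).symm]
  refine tendsto_nhds_unique (h𝒢.tendsto_trace hτ hE (φ Y) X)
    ((h𝒢.tendsto_trace hτ hE Y X).congr' ?_)
  filter_upwards [h𝒢.eventually_comp_eq hφ] with ψ hψ
  rw [← (h𝒢.proj φ hφ).symm, hψ]

theorem limit_idem (hτ : IsFaithfulNormalTrace M τ) (h𝒢 : IsProjectionSemigroup τ 𝒢)
    (hE : NetWeaklyConverges M 𝒢 E) (X : Elem M) : E (E X) = E X := by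
  have := h𝒢.netFilter_neBot
  refine hτ.eq_of_forall fun Y => tendsto_nhds_unique (h𝒢.tendsto_trace hτ hE Y (E X)) ?_
  exact tendsto_const_nhds.congr fun φ => by rw [h𝒢.apply_limit hτ hE φ.2]

theorem norm_limit_le (hτ : IsFaithfulNormalTrace M τ) (h𝒢 : IsProjectionSemigroup τ 𝒢)
    (hE : NetWeaklyConverges M 𝒢 E) (X : Elem M) : ‖E X‖ ≤ ‖X‖ :=
  have := h𝒢.netFilter_neBot
  (hτ.tendsto_of_trace (fun φ : 𝒢 => (h𝒢.proj φ φ.2).norm_le X)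
    fun Y => h𝒢.tendsto_trace hτ hE Y X).1

theorem isPositive_limit (h𝒢 : IsProjectionSemigroup τ 𝒢)
    (hE : NetWeaklyConverges M 𝒢 E) {X : Elem M} (hX : (X : H →L[ℂ] H).IsPositive) :
    (E X : H →L[ℂ] H).IsPositive :=
  have := h𝒢.netFilter_neBot
  isPositive_of_tendsto (Eventually.of_forall fun φ : 𝒢 => (h𝒢.proj φ φ.2).pos X hX)
    fun l hl => h𝒢.netWeaklyConverges_iff.1 hE l hl X

/-- The trace forces the image of the unit under the limit to be a projection. -/
theorem limit_one_mul_self (hτ : IsFaithfulNormalTrace M τ) (h𝒢 : IsProjectionSemigroup τ 𝒢)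
    (hE : NetWeaklyConverges M 𝒢 E) : E 1 * E 1 = E 1 := by
  have hpos : (0 : H →L[ℂ] H) ≤ (E 1 : H →L[ℂ] H) :=
    (ContinuousLinearMap.nonneg_iff_isPositive _).2
      (h𝒢.isPositive_limit hE ContinuousLinearMap.isPositive_one)
  have hle : (E 1 : H →L[ℂ] H) ≤ 1 :=
    (CStarAlgebra.norm_le_one_iff_of_nonneg _ hpos).1
      ((h𝒢.norm_limit_le hτ hE 1).trans norm_one_elem_le)
  have hmul : (0 : H →L[ℂ] H) ≤ (E 1 : H →L[ℂ] H) * (1 - (E 1 : H →L[ℂ] H)) :=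
    Commute.mul_nonneg hpos (sub_nonneg.2 hle) ((Commute.one_right _).sub_right (Commute.refl _))
  -- A product of commuting positive operators is positive, and its trace vanishes because `τ (E 1 *
  -- E 1) = τ (E (E 1)) = τ (E 1)`.
  have hzero : E 1 * (1 - E 1) = 0 := by
    refine hτ.faithful _ ((ContinuousLinearMap.nonneg_iff_isPositive _).1 hmul) ?_
    rw [mul_sub, mul_one, map_sub, h𝒢.limit_symm hτ hE, h𝒢.limit_idem hτ hE, mul_one, sub_self]
  rw [mul_sub, mul_one, sub_eq_zero] at hzero
  exact hzero.symm

/-- Hence, if the image of the unit is injective, it is the unit. -/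
theorem limit_one_eq_one (hτ : IsFaithfulNormalTrace M τ) (h𝒢 : IsProjectionSemigroup τ 𝒢)
    (hE : NetWeaklyConverges M 𝒢 E) (hinj : Function.Injective (E 1 : H →L[ℂ] H)) : E 1 = 1 := by
  have h := congrArg Subtype.val (h𝒢.limit_one_mul_self hτ hE)
  refine Subtype.ext (ContinuousLinearMap.ext fun x => hinj ?_)
  exact congrArg (fun f : H →L[ℂ] H => f x) h

end Limit

end IsProjectionSemigroup

/-! ### Abelian sets dominated by a regular gauge -/

section Family

variable {p : ℕ → ℝ} {c : ℝ} {S : Set (Elem M)}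

theorem WeaklyAlmostConverges.unique (hτ : IsFaithfulNormalTrace M τ) {u : ℕ → Elem M → Elem M}
    {φ ψ : Elem M →L[ℂ] Elem M} (hφ : WeaklyAlmostConverges M u φ)
    (hψ : WeaklyAlmostConverges M u ψ) : φ = ψ := by
  ext1 X
  refine hτ.eq_of_forall fun Y => ?_
  have hl := hτ.normal.mul_left Y
  have h1 := (hφ.converges _ hl X).tendsto 0
  have h2 := ((hψ.converges _ hl X).add
    (almostConverges_const (τ (Y * ψ X) - τ (Y * φ X)))).tendsto 0
  refine (sub_eq_zero.1 ?_).symm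
  rw [zero_add] at h2
  refine tendsto_nhds_unique h2 ?_
  refine h1.congr fun n => ?_
  congr 1
  funext i
  simp [mul_sub]

/-- The weak almost limits of the elements of an abelian dominated set generate a commutative
semigroup of trace projections. -/
theorem isProjectionSemigroup_closure (hτ : IsFaithfulNormalTrace M τ) (hp : IsRegularGauge p c)
    (hS : S.Nonempty) (hcomm : ∀ A ∈ S, ∀ B ∈ S, A * B = B * A)
    (hdom : ∀ T ∈ S, IsDominatedBy M T p) {e : Elem M → (Elem M →L[ℂ] Elem M)}
    (he : ∀ T ∈ S, WeaklyAlmostConverges M (conjMap M p T) (e T)) :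
    IsProjectionSemigroup τ (Subsemigroup.closure (e '' S)) := by
  have key : ∀ T ∈ S, (∀ X, toL2 hτ (e T X) = fixedProj hτ c T (toL2 hτ X)) ∧
      IsTraceProjection τ (e T) := by
    intro T hT
    obtain ⟨φ, h1, h2, h3, -⟩ := exists_almostLimit hτ hp (hdom T hT)
    obtain rfl := (he T hT).unique hτ h2
    exact ⟨h1, h3⟩
  have hgen : ∀ φ ∈ e '' S, ∀ ψ ∈ e '' S, φ * ψ = ψ * φ := by
    rintro _ ⟨A, hA, rfl⟩ _ ⟨B, hB, rfl⟩
    ext1 X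
    refine toL2_injective hτ ?_
    change toL2 hτ (e A (e B X)) = toL2 hτ (e B (e A X))
    rw [(key A hA).1, (key B hB).1, (key B hB).1, (key A hA).1]
    exact fixedProj_comm hτ hp (hdom A hA) (hdom B hB) (hcomm A hA B hB) _
  have hcl : ∀ φ ∈ Subsemigroup.closure (e '' S), ∀ ψ ∈ Subsemigroup.closure (e '' S),
      φ * ψ = ψ * φ := fun φ hφ ψ hψ =>
    congrArg Subtype.val ((Subsemigroup.isMulCommutative_closure _ hgen).is_comm.comm ⟨φ, hφ⟩ ⟨ψ, hψ⟩)
  refine ⟨?_, fun φ hφ ψ hψ => mul_mem hφ hψ, hcl, fun φ hφ => ?_⟩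
  · obtain ⟨T, hT⟩ := hS
    exact ⟨e T, Subsemigroup.subset_closure ⟨T, hT, rfl⟩⟩
  · induction hφ using Subsemigroup.closure_induction with
    | mem φ h =>
      obtain ⟨T, hT, rfl⟩ := h
      exact (key T hT).2
    | mul φ ψ hφ hψ h1 h2 => exact h1.comp h2 (hcl φ hφ ψ hψ)

theorem existsUnique_isNetLimit (hτ : IsFaithfulNormalTrace M τ) (hp : IsRegularGauge p c)
    (hS : S.Nonempty) (hcomm : ∀ A ∈ S, ∀ B ∈ S, A * B = B * A)
    (hdom : ∀ T ∈ S, IsDominatedBy M T p) : ∃! E : Elem M →L[ℂ] Elem M, IsNetLimit M p S E := by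
  have hex : ∀ T, ∃ φ, T ∈ S → WeaklyAlmostConverges M (conjMap M p T) φ := by
    intro T
    by_cases hT : T ∈ S
    · obtain ⟨φ, -, h, -⟩ := exists_almostLimit hτ hp (hdom T hT)
      exact ⟨φ, fun _ => h⟩
    · exact ⟨0, fun h => absurd h hT⟩
  choose e he using hex
  have h𝒢 := isProjectionSemigroup_closure hτ hp hS hcomm hdom he
  obtain ⟨E, hE⟩ := h𝒢.exists_limit hτ
  refine ⟨E, ⟨e, he, hE⟩, ?_⟩
  rintro E' ⟨e', he', hE'⟩
  -- Almost limits are unique, so the semigroup does not depend on the choice of `e`, whose values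
  -- outside `S` are irrelevant.
  have : e' '' S = e '' S := Set.image_congr fun T hT => (he' T hT).unique hτ (he T hT)
  rw [this] at hE'
  exact h𝒢.limit_unique hτ hE' hE

theorem isRegularGauge_one : IsRegularGauge (fun _ => 1) 1 := by
  have h : AlmostConverges (fun _ : ℕ => (0 : ℝ)) 0 := almostConverges_const 0
  refine ⟨⟨fun _ => one_pos, one_pos, ?_⟩, ?_⟩ <;>
  · unfold StronglyAlmostConverges
    simpa using h

/-- An isometry of `M` is unitary, since `M` has a faithful trace. -/
theorem IsFaithfulNormalTrace.mem_unitary (hτ : IsFaithfulNormalTrace M τ) {V : Elem M}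
    (hV : star V * V = 1) : V ∈ unitary (Elem M) := by
  refine Unitary.mem_iff.2 ⟨hV, ?_⟩
  -- The defect `1 - V V*` is a projection, of trace `τ 1 - τ (V* V) = 0`.
  have h1 : star (1 - V * star V) * (1 - V * star V) = 1 - V * star V := by
    have : V * star V * (V * star V) = V * star V := by
      rw [mul_assoc, ← mul_assoc (star V), hV, one_mul]
    simp only [star_sub, star_one, star_mul, star_star, sub_mul, mul_sub, one_mul, mul_one, this]
    abel
  have h2 : star (1 - V * star V) * (1 - V * star V) = 0 := by
    refine hτ.faithful _ (isPositive_star_mul_self _) ?_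
    rw [h1, map_sub, hτ.trace, hV, sub_self]
  rw [h1] at h2
  exact (sub_eq_zero.1 h2).symm

theorem isDominatedBy_one_of_mem_unitary {V : Elem M} (hV : V ∈ unitary (Elem M)) :
    IsDominatedBy M V (fun _ => 1) := by
  intro n _
  have h := norm_one_elem_le (M := M)
  rw [← Unitary.star_mul_self_of_mem (pow_mem hV n), CStarRing.norm_star_mul_self] at h
  nlinarith [norm_nonneg (V ^ n)]

theorem normalized_one (V : Elem M) : normalized 1 V = V := by simp [normalized]

theorem sqrt_one : sqrt M 1 = 1 := Subtype.ext CFC.sqrt_one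

/-- If the net limit maps the unit to an injective operator, then the normalised elements are
unitary. -/
theorem normalized_mem_unitary (hτ : IsFaithfulNormalTrace M τ) (hp : IsRegularGauge p c)
    (hdom : ∀ T ∈ S, IsDominatedBy M T p) {e : Elem M → (Elem M →L[ℂ] Elem M)}
    (he : ∀ T ∈ S, WeaklyAlmostConverges M (conjMap M p T) (e T))
    (h𝒢 : IsProjectionSemigroup τ (Subsemigroup.closure (e '' S) : Set (Elem M →L[ℂ] Elem M)))
    {E : Elem M →L[ℂ] Elem M}
    (hE : NetWeaklyConverges M (Subsemigroup.closure (e '' S)) E) (hE1 : E 1 = 1)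
    {T : Elem M} (hT : T ∈ S) : normalized c T ∈ unitary (Elem M) := by
  obtain ⟨φ, -, h2, -, h4⟩ := exists_almostLimit hτ hp (hdom T hT)
  obtain rfl := (he T hT).unique hτ h2
  have h1 : e T 1 = 1 := by
    have := h𝒢.apply_limit hτ hE (Subsemigroup.subset_closure ⟨T, hT, rfl⟩) 1
    rwa [hE1] at this
  have h5 := h4 1
  rw [h1, mul_one] at h5
  exact hτ.mem_unitary h5

/-- For a unitary normalisation, the gauge `p` and the constant gauge give the same almost limit. -/
theorem WeaklyAlmostConverges.const_gauge (hτ : IsFaithfulNormalTrace M τ)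
    (hp : IsRegularGauge p c) {T : Elem M} (hT : IsDominatedBy M T p)
    (hV : normalized c T ∈ unitary (Elem M)) {φ : Elem M →L[ℂ] Elem M}
    (hφ : WeaklyAlmostConverges M (conjMap M p T) φ) :
    WeaklyAlmostConverges M (conjMap M (fun _ => 1) (normalized c T)) φ := by
  obtain ⟨φ', h1, h2, -⟩ := exists_almostLimit hτ hp hT
  obtain rfl := hφ.unique hτ h2
  obtain ⟨ψ, h3, h4, -⟩ :=
    exists_almostLimit hτ isRegularGauge_one (isDominatedBy_one_of_mem_unitary hV)
  have : φ = ψ := by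
    ext1 X
    refine toL2_injective hτ ?_
    rw [h1, h3]
    exact (congrArg (fun V => (fixedSpace (conjL2 hτ V)).starProjection (toL2 hτ X))
      (normalized_one _)).symm
  exact this ▸ h4

end Family

end VNSemigroup

end

/-! ### The main theorem, with `E 1 = 1`, `U_T = T / c` and `F = E` -/

open VNSemigroup in
theorem proposition2p8 {H : Type*} [NormedAddCommGroup H] [InnerProductSpace ℂ H]
    [CompleteSpace H] [TopologicalSpace.SeparableSpace H]
    (M : VonNeumannAlgebra H)
    (τ : Elem M →ₗ[ℂ] ℂ) (hτ : IsFaithfulNormalTrace M τ)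
    (p : ℕ → ℝ) (c : ℝ) (hp : IsRegularGauge p c)
    (S : Set (Elem M)) (hS : S.Nonempty)
    (hcomm : ∀ A ∈ S, ∀ B ∈ S, A * B = B * A)
    (hdom : ∀ T ∈ S, IsDominatedBy M T p) :
    (∃! E : Elem M →L[ℂ] Elem M, IsNetLimit M p S E) ∧
    ∀ E : Elem M →L[ℂ] Elem M, IsNetLimit M p S E →
      Function.Injective (E 1 : H →L[ℂ] H) →
      ∃ (S₁ : Set (Elem M)) (U : Elem M → Elem M), S₁ = U '' S ∧
        (∀ V ∈ S₁, V ∈ unitary (Elem M)) ∧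
        (∀ V ∈ S₁, ∀ W ∈ S₁, V * W = W * V) ∧
        (∀ T ∈ S, sqrt M (E 1) * T = (c : ℂ) • (U T * sqrt M (E 1))) ∧
        ∃ F : Elem M →L[ℂ] Elem M, IsNetLimit M (fun _ => 1) S₁ F ∧
          (∀ X : Elem M, E (sqrt M (E 1) * X * sqrt M (E 1)) =
            sqrt M (E 1) * F X * sqrt M (E 1)) ∧
          ∃ Ehat Fhat : Elem M →L[ℂ] Elem M,
            IsTraceDual M τ E Ehat ∧ IsTraceDual M τ F Fhat ∧
            ∀ X : Elem M, sqrt M (E 1) * Ehat X * sqrt M (E 1) =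
              Fhat (sqrt M (E 1) * X * sqrt M (E 1)) := by
  refine ⟨existsUnique_isNetLimit hτ hp hS hcomm hdom, ?_⟩
  rintro E ⟨e, he, hE⟩ hinj
  have h𝒢 := isProjectionSemigroup_closure hτ hp hS hcomm hdom he
  have hE1 : E 1 = 1 := h𝒢.limit_one_eq_one hτ hE hinj
  have hU : ∀ T ∈ S, normalized c T ∈ unitary (Elem M) := fun T hT =>
    normalized_mem_unitary hτ hp hdom he h𝒢 hE hE1 hT
  have hc : (c : ℂ) ≠ 0 := Complex.ofReal_ne_zero.2 hp.const_pos.ne'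
  have hcT : ∀ T : Elem M, (c : ℂ) • normalized c T = T := fun T => by
    rw [normalized, smul_smul, mul_inv_cancel₀ hc, one_smul]
  have hdual : IsTraceDual M τ E E :=
    ⟨hτ.isWeakStarContinuous (h𝒢.limit_symm hτ hE), h𝒢.limit_symm hτ hE⟩
  refine ⟨normalized c '' S, normalized c, rfl, ?_, ?_, fun T _ => ?_, E, ?_, fun X => ?_,
    E, E, hdual, hdual, fun X => ?_⟩
  · rintro _ ⟨T, hT, rfl⟩
    exact hU T hT
  · rintro _ ⟨A, hA, rfl⟩ _ ⟨B, hB, rfl⟩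
    simp only [normalized, smul_mul_smul_comm, hcomm A hA B hB]
  · rw [hE1, sqrt_one, one_mul, mul_one, hcT]
  -- Rescaling by `c` recovers `T` from `U_T`, so both gauges have the same generators and the same
  -- net.
  · refine ⟨fun V => e ((c : ℂ) • V), ?_, ?_⟩
    · rintro _ ⟨T, hT, rfl⟩
      simp only [hcT]
      exact (he T hT).const_gauge hτ hp (hdom T hT) (hU T hT)
    · rw [Set.image_image]
      simp only [hcT]
      exact hE
  · simp only [hE1, sqrt_one, one_mul, mul_one]
  · simp only [hE1, sqrt_one, one_mul, mul_one]
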